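/- All graphs are finite, undirected, without loops or multiple edges. A graph is outerplanar if it can be embedded in the plane (vertices as distinct points, edges as simple polygonal arcs between their ends that meet one another and the vertices only at common ends) so that all its vertices lie on the boundary of the unbounded face. It is 2-connected if it has at least three vertices, is connected, and stays connected after the deletion of any single vertex. An interval $t$-coloring of a graph $G$ is a proper edge-coloring of $G$ with colors $1,\dots,t$ such that all colors are used and, for every vertex $v$, the set of colors of the edges incident to $v$ is an interval of integers. $G$ is interval colorable if it has an interval $t$-coloring for some positive integer $t$, and $w(G)$ then denotes the least such $t$. Theorem. If $G$ is a 2-connected outerplanar graph with maximum degree $\Delta(G)\le 3$ and $G$ is not an odd cycle, then $G$ is interval colorable and $w(G)\le 4$. -/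

import Mathlib

open Set

namespace SimpleGraph

/-- `IsPolygonalArc a b A`: the set `A` in the plane is a simple polygonal arc from `a` to `b`,
that is, a union of finitely many nondegenerate straight segments laid end to end, starting at `a`
and ending at `b`, which does not meet itself. -/
inductive IsPolygonalArc : ℝ × ℝ → ℝ × ℝ → Set (ℝ × ℝ) → Prop
  | single (a b : ℝ × ℝ) (hab : a ≠ b) : IsPolygonalArc a b (segment ℝ a b)
  | cons (a b c : ℝ × ℝ) (A : Set (ℝ × ℝ)) (hab : a ≠ b) (hA : IsPolygonalArc b c A)
      (hd : segment ℝ a b ∩ A = {b}) : IsPolygonalArc a c (segment ℝ a b ∪ A)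

/-- An embedding of the graph `G` in the plane (a drawing without crossings): the vertices are
distinct points, each edge is a simple polygonal arc joining the points of its ends, an edge
contains no vertex other than its ends, and two distinct edges meet only in points that represent
common ends. -/
structure PlaneEmbedding {V : Type*} (G : SimpleGraph V) where
  /-- the point of a vertex -/
  point : V → ℝ × ℝ
  /-- the arc of an edge -/
  arc : G.edgeSet → Set (ℝ × ℝ)
  point_injective : Function.Injective point
  isPolygonalArc : ∀ (u v : V) (h : G.Adj u v),
    IsPolygonalArc (point u) (point v) (arc ⟨s(u, v), h⟩)
  mem_of_point_mem : ∀ (e : G.edgeSet) (w : V), point w ∈ arc e → w ∈ e.1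
  arc_inter : ∀ e f : G.edgeSet, e ≠ f →
    ∀ x ∈ arc e ∩ arc f, ∃ w : V, w ∈ e.1 ∧ w ∈ f.1 ∧ point w = x

namespace PlaneEmbedding

variable {V : Type*} {G : SimpleGraph V}

/-- The set of all points of the plane used by the embedding. -/
def carrier (P : G.PlaneEmbedding) : Set (ℝ × ℝ) :=
  range P.point ∪ ⋃ e, P.arc e

/-- The faces of an embedding are the connected components of the complement of its carrier. -/
def IsFace (P : G.PlaneEmbedding) (F : Set (ℝ × ℝ)) : Prop :=
  ∃ x ∈ P.carrierᶜ, F = connectedComponentIn P.carrierᶜ x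

end PlaneEmbedding

/-- A graph is outerplanar if it can be embedded in the plane so that all its vertices lie on (the
boundary of) the unbounded face. -/
def IsOuterplanar {V : Type*} (G : SimpleGraph V) : Prop :=
  ∃ (P : G.PlaneEmbedding) (F : Set (ℝ × ℝ)), P.IsFace F ∧ ¬ Bornology.IsBounded F ∧
    ∀ v : V, P.point v ∈ frontier F

/-- A graph is 2-connected if it has at least three vertices, is connected, and remains connected
when any one vertex is deleted. -/
def IsTwoConnected {V : Type*} (G : SimpleGraph V) : Prop :=
  2 < ENat.card V ∧ G.Connected ∧ ∀ v : V, (G.induce {v}ᶜ).Connected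

/-- `G` is a cycle of odd length. -/
def IsOddCycle {V : Type*} (G : SimpleGraph V) : Prop :=
  ∃ n : ℕ, 3 ≤ n ∧ Odd n ∧ Nonempty (G ≃g cycleGraph n)

/-- An interval `t`-coloring: a proper edge-coloring with the colors `1, …, t`, all of them used,
such that at every vertex the colors of the incident edges form an interval of integers. -/
structure IsIntervalColoring {V : Type*} (G : SimpleGraph V) (t : ℕ) (α : G.EdgeLabeling ℕ) :
    Prop where
  /-- adjacent edges receive different colors -/
  proper : ∀ (e f : G.edgeSet) (v : V), e ≠ f → v ∈ e.1 → v ∈ f.1 → α e ≠ α f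
  /-- the colors used are exactly `1, …, t` -/
  range_eq : range (fun e : G.edgeSet => α e) = Icc 1 t
  /-- the spectrum of each vertex is an interval -/
  interval : ∀ v : V, ∃ a b : ℕ, {c : ℕ | ∃ e : G.edgeSet, v ∈ e.1 ∧ α e = c} = Icc a b

/-- A graph is interval colorable if it has an interval `t`-coloring for some positive `t`. -/
def IsIntervalColorable {V : Type*} (G : SimpleGraph V) : Prop :=
  ∃ t : ℕ, 0 < t ∧ ∃ α : G.EdgeLabeling ℕ, G.IsIntervalColoring t α

/-- `w(G)`: the least positive `t` such that `G` has an interval `t`-coloring; meaningful for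
interval colorable graphs only. -/
noncomputable def minIntervalColors {V : Type*} (G : SimpleGraph V) : ℕ :=
  sInf {t : ℕ | 0 < t ∧ ∃ α : G.EdgeLabeling ℕ, G.IsIntervalColoring t α}

end SimpleGraph

/-! Outerplanarity enters only through `IsThetaFree`, which follows from an angle argument. Off a
polygonal arc from a to b, the angle under which a and b are seen has a continuous real branch. For
three arcs that are disjoint apart from their ends, the difference of two branches is a multiple of
2π, constant on a face together with the inner points of the third arc if the face accumulates at
one of them. It can therefore be computed by approaching a along that third arc. Adding the three
differences cyclically shows that certain signed angles at a add up to 0, whereas their sum is π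
modulo 2π (`theta_arcs_false`).

In a 2-connected theta-free graph a longest cycle is Hamiltonian, because an ear would either
lengthen it or create a theta. Crossing chords create a theta as well, unless there are just four
vertices. Since degrees are at most 3, the chords form a matching.

If the cycle has even length, two consecutive colors alternate on it and all chords get a third
color next to them. If the length is odd, there is a chord and no two chords cross. Cutting the
cycle in one edge leaves a path with non-crossing chords, which is built by prepending a chordless
vertex, enclosing a path by a chord, and concatenating. Each piece is summarized by a relation on
four colors: pairs of colors of its two outermost edges that extend to the piece. Fourteen relations
suffice (`IsChordMap.exists_mask`). Once a chord is present, the relation contains a pair of equal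
colors, unless a chord joins the two end vertices of the path, which cannot happen here; so the
cycle closes up. Connectedness makes the set of all used colors an interval, which is then shifted
to start at 1. -/

namespace SimpleGraph

open Filter Topology

/-! ### Polygonal arcs: concatenation and connectedness without the ends -/

namespace IsPolygonalArc

variable {a b c : ℝ × ℝ} {A B : Set (ℝ × ℝ)}

theorem left_mem (h : IsPolygonalArc a b A) : a ∈ A := by
  cases h with
  | single _ _ h => exact left_mem_segment ℝ _ _
  | cons _ b _ A hab hA hd => exact Or.inl (left_mem_segment ℝ _ _)

theorem right_mem (h : IsPolygonalArc a b A) : b ∈ A := by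
  induction h with
  | single _ _ h => exact right_mem_segment ℝ _ _
  | cons _ b _ A hab hA hd ih => exact Or.inr ih

theorem ne (h : IsPolygonalArc a b A) : a ≠ b := by
  cases h with
  | single _ _ h => exact h
  | cons _ b _ A hab hA hd =>
    rintro rfl
    have : a ∈ segment ℝ a b ∩ A := ⟨left_mem_segment ℝ _ _, hA.right_mem⟩
    rw [hd] at this
    exact hab this

theorem isClosed (h : IsPolygonalArc a b A) : IsClosed A := by
  have key : ∀ x y : ℝ × ℝ, IsClosed (segment ℝ x y) := fun x y => by
    rw [segment_eq_image_lineMap]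
    exact (isCompact_Icc.image (by fun_prop)).isClosed
  induction h with
  | single a b h => exact key a b
  | cons a b _ A hab hA hd ih => exact (key a b).union ih

theorem trans (hA : IsPolygonalArc a b A) (hB : IsPolygonalArc b c B) (h : A ∩ B = {b}) :
    IsPolygonalArc a c (A ∪ B) := by
  induction hA with
  | single a b hab => exact cons a b c B hab hB h
  | cons a x b A hax hA hd ih =>
    have hAB : A ∩ B = {b} := by
      apply Subset.antisymm
      · rw [← h]; exact inter_subset_inter_left _ subset_union_right
      · rintro _ rfl; exact ⟨hA.right_mem, hB.left_mem⟩
    rw [union_assoc]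
    refine cons a x c _ hax (ih hB hAB) ?_
    apply Subset.antisymm
    · rintro y ⟨hy, hy' | hy'⟩
      · rw [← hd]; exact ⟨hy, hy'⟩
      · have hyb : y ∈ (segment ℝ a x ∪ A) ∩ B := ⟨Or.inl hy, hy'⟩
        rw [h] at hyb
        obtain rfl : y = b := hyb
        rw [← hd]; exact ⟨hy, hA.right_mem⟩
    · rintro _ rfl; exact ⟨right_mem_segment ℝ _ _, Or.inl hA.left_mem⟩

theorem isPreconnected_segment_diff_left (hab : a ≠ b) :
    IsPreconnected (segment ℝ a b \ {a}) := by
  have : segment ℝ a b \ {a} = AffineMap.lineMap a b '' Ioc (0 : ℝ) 1 := by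
    rw [segment_eq_image_lineMap]
    ext y
    constructor
    · rintro ⟨⟨t, ht, rfl⟩, hy⟩
      refine ⟨t, ⟨lt_of_le_of_ne ht.1 ?_, ht.2⟩, rfl⟩
      rintro rfl
      simp at hy
    · rintro ⟨t, ht, rfl⟩
      refine ⟨⟨t, ⟨ht.1.le, ht.2⟩, rfl⟩, ?_⟩
      simp [hab, ht.1.ne']
  rw [this]
  exact isPreconnected_Ioc.image _ (by fun_prop)

theorem isPreconnected_diff_right (h : IsPolygonalArc a b A) : IsPreconnected (A \ {b}) := by
  induction h with
  | single a b h =>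
    rw [segment_symm]
    exact isPreconnected_segment_diff_left h.symm
  | cons a b c A hab hA hd ih =>
    have hc : c ∉ segment ℝ a b := fun hc => by
      have : c ∈ segment ℝ a b ∩ A := ⟨hc, hA.right_mem⟩
      rw [hd] at this
      exact hA.ne this.symm
    rw [union_sdiff_distrib, sdiff_singleton_eq_self hc]
    exact (convex_segment a b).isPreconnected.union b (right_mem_segment ℝ _ _)
      ⟨hA.left_mem, hA.ne⟩ ih

/-- Allows the inner points of an arc to be attached to a face without losing connectedness. -/
theorem isPreconnected_diff (h : IsPolygonalArc a b A) : IsPreconnected (A \ {a, b}) := by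
  cases h with
  | single a b h =>
    have : segment ℝ a b \ {a, b} = openSegment ℝ a b := by
      ext y
      constructor
      · rintro ⟨hy, hy'⟩
        simp only [mem_insert_iff, mem_singleton_iff, not_or] at hy'
        exact mem_openSegment_of_ne_left_right (Ne.symm hy'.1) (Ne.symm hy'.2) hy
      · intro hy
        refine ⟨openSegment_subset_segment ℝ _ _ hy, ?_⟩
        rintro (rfl | rfl)
        · exact h (left_mem_openSegment_iff.1 hy)
        · exact h (right_mem_openSegment_iff.1 hy)
    rw [this]
    exact (convex_openSegment a b).isPreconnected
  | cons _ x _ A hab hA hd =>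
    have hb : b ∉ segment ℝ a x := fun hc => by
      have : b ∈ segment ℝ a x ∩ A := ⟨hc, hA.right_mem⟩
      rw [hd] at this
      exact hA.ne this.symm
    have ha : a ∉ A := fun hc => by
      have : a ∈ segment ℝ a x ∩ A := ⟨left_mem_segment ℝ _ _, hc⟩
      rw [hd] at this
      exact hab this
    have : (segment ℝ a x ∪ A) \ {a, b} = (segment ℝ a x \ {a}) ∪ (A \ {b}) := by
      ext y
      simp only [Set.mem_sdiff, mem_union, mem_insert_iff, mem_singleton_iff, not_or]
      constructor
      · tauto
      · rintro (⟨h1, h2⟩ | ⟨h1, h2⟩)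
        · exact ⟨Or.inl h1, h2, fun h => hb (h ▸ h1)⟩
        · exact ⟨Or.inr h1, fun h => ha (h ▸ h1), h2⟩
    rw [this]
    exact (isPreconnected_segment_diff_left hab).union x
      ⟨right_mem_segment ℝ _ _, hab.symm⟩ ⟨hA.left_mem, hA.ne⟩ hA.isPreconnected_diff_right

end IsPolygonalArc

/-! ### Continuous branches of the view angle, and the exclusion of theta configurations -/

/-- The point of the plane as a complex number. -/
noncomputable def planeToComplex : (ℝ × ℝ) ≃L[ℝ] ℂ := Complex.equivRealProdCLM.symm

local notation "ζ" => planeToComplex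

/-- The signed angle under which the segment from `a` to `b` is seen from `p`. -/
noncomputable def viewAngle (a b p : ℝ × ℝ) : ℝ := Complex.arg ((ζ b - ζ p) / (ζ a - ζ p))

/-- If the quotient were a real number -r ≤ 0, then p would be the convex combination of a and b
with weights r / (1 + r) and 1 / (1 + r). -/
theorem viewAngle_div_mem_slitPlane {a b p : ℝ × ℝ} (hp : p ∉ segment ℝ a b) :
    (ζ b - ζ p) / (ζ a - ζ p) ∈ Complex.slitPlane := by
  rw [Complex.mem_slitPlane_iff_not_le_zero]
  intro hle
  have hap : ζ a - ζ p ≠ 0 := by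
    rw [sub_ne_zero]
    rintro h
    exact hp (planeToComplex.injective h ▸ left_mem_segment ℝ _ _)
  obtain ⟨h1, h2⟩ := Complex.le_def.1 hle
  set z := (ζ b - ζ p) / (ζ a - ζ p) with hz
  have hzr : z = ((z.re : ℝ) : ℂ) := by
    apply Complex.ext <;> simp_all
  set r := -z.re with hr
  have hr0 : 0 ≤ r := by simpa [hr] using h1
  have hmul : ζ b - ζ p = -(r : ℂ) * (ζ a - ζ p) := by
    have : ζ b - ζ p = z * (ζ a - ζ p) := by rw [hz]; field_simp
    rw [this, hzr, hr]; push_cast; simp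
  have hpos : (0 : ℝ) < 1 + r := by linarith
  apply hp
  refine ⟨r / (1 + r), 1 / (1 + r), by positivity, by positivity, by field_simp; ring, ?_⟩
  apply planeToComplex.injective
  rw [map_add, map_smul, map_smul, Complex.real_smul, Complex.real_smul]
  have : (1 + r : ℂ) ≠ 0 := by exact_mod_cast hpos.ne'
  push_cast
  field_simp
  linear_combination hmul

theorem continuousAt_viewAngle {a b p : ℝ × ℝ} (hp : p ∉ segment ℝ a b) :
    ContinuousAt (viewAngle a b) p := by
  have hap : ζ a - ζ p ≠ 0 := by
    rw [sub_ne_zero]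
    rintro h
    exact hp (planeToComplex.injective h ▸ left_mem_segment ℝ _ _)
  apply ContinuousAt.comp (g := Complex.arg)
    (f := fun p => (ζ b - ζ p) / (ζ a - ζ p)) (Complex.continuousAt_arg (viewAngle_div_mem_slitPlane hp))
  exact ContinuousAt.div (by fun_prop) (by fun_prop) hap

theorem viewAngle_coe {a b p : ℝ × ℝ} (ha : p ≠ a) (hb : p ≠ b) :
    (viewAngle a b p : Real.Angle) =
      Complex.arg (ζ b - ζ p) - Complex.arg (ζ a - ζ p) := by
  apply Complex.arg_div_coe_angle <;> rw [sub_ne_zero]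
  · exact fun h => hb (planeToComplex.injective h).symm
  · exact fun h => ha (planeToComplex.injective h).symm

/-- `IsAngleFunction a b A θ`: off the closed set `A` the function `θ` is a continuous choice of the
angle under which the pair `a`, `b` is seen. -/
structure IsAngleFunction (a b : ℝ × ℝ) (A : Set (ℝ × ℝ)) (θ : ℝ × ℝ → ℝ) : Prop where
  continuousAt : ∀ p ∉ A, ContinuousAt θ p
  coe_eq : ∀ p ∉ A, (θ p : Real.Angle) = Complex.arg (ζ b - ζ p) - Complex.arg (ζ a - ζ p)

theorem isAngleFunction_viewAngle (a b : ℝ × ℝ) :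
    IsAngleFunction a b (segment ℝ a b) (viewAngle a b) where
  continuousAt _ hp := continuousAt_viewAngle hp
  coe_eq _ hp := viewAngle_coe (fun h => hp (h ▸ left_mem_segment ℝ _ _))
    (fun h => hp (h ▸ right_mem_segment ℝ _ _))

theorem IsAngleFunction.add {a b c : ℝ × ℝ} {A B : Set (ℝ × ℝ)} {θ η : ℝ × ℝ → ℝ}
    (hθ : IsAngleFunction a b A θ) (hη : IsAngleFunction b c B η) :
    IsAngleFunction a c (A ∪ B) (fun p => θ p + η p) where
  continuousAt p hp := (hθ.continuousAt p fun h => hp (Or.inl h)).add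
    (hη.continuousAt p fun h => hp (Or.inr h))
  coe_eq p hp := by
    rw [Real.Angle.coe_add, hθ.coe_eq p fun h => hp (Or.inl h),
      hη.coe_eq p fun h => hp (Or.inr h)]
    abel

theorem IsPolygonalArc.exists_isAngleFunction {a b : ℝ × ℝ} {A : Set (ℝ × ℝ)}
    (h : IsPolygonalArc a b A) : ∃ θ, IsAngleFunction a b A θ := by
  induction h with
  | single a b h => exact ⟨_, isAngleFunction_viewAngle a b⟩
  | cons a b c A hab hA hd ih =>
    obtain ⟨η, hη⟩ := ih
    exact ⟨_, (isAngleFunction_viewAngle a b).add hη⟩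

/-- The first segment of a polygonal arc, and an angle function continued to the starting point
of the arc. -/
theorem IsPolygonalArc.exists_first_segment {a b : ℝ × ℝ} {A : Set (ℝ × ℝ)}
    (h : IsPolygonalArc a b A) : ∃ (c : ℝ × ℝ) (η : ℝ × ℝ → ℝ), a ≠ c ∧ segment ℝ a c ⊆ A ∧
      ContinuousAt η a ∧ IsAngleFunction a b A (fun p => viewAngle a c p + η p) := by
  cases h with
  | single _ _ h =>
    refine ⟨b, fun _ => 0, h, Subset.rfl, continuousAt_const, ?_⟩
    simpa using isAngleFunction_viewAngle a b
  | cons _ x _ A hab hA hd =>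
    obtain ⟨η, hη⟩ := hA.exists_isAngleFunction
    refine ⟨x, η, hab, subset_union_left, hη.continuousAt a fun hc => ?_,
      (isAngleFunction_viewAngle a x).add hη⟩
    have : a ∈ segment ℝ a x ∩ A := ⟨left_mem_segment ℝ _ _, hc⟩
    rw [hd] at this
    exact hab this

/-- A continuous real function that vanishes modulo `2π` is constant on preconnected sets. -/
theorem eq_of_isPreconnected_of_coe_eq_zero {S : Set (ℝ × ℝ)} (hS : IsPreconnected S)
    {D : ℝ × ℝ → ℝ} (hD : ContinuousOn D S) (h0 : ∀ p ∈ S, (D p : Real.Angle) = 0)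
    {x y : ℝ × ℝ} (hx : x ∈ S) (hy : y ∈ S) : D x = D y := by
  have hmaps : MapsTo D S (range fun n : ℤ => (n : ℝ) * (2 * Real.pi)) := fun p hp => by
    obtain ⟨n, hn⟩ := Real.Angle.coe_eq_zero_iff.1 (h0 p hp)
    exact ⟨n, by simpa using hn⟩
  have : DiscreteTopology (range fun n : ℤ => (n : ℝ) * (2 * Real.pi)) := by
    have : (range fun n : ℤ => (n : ℝ) * (2 * Real.pi)) =
        (AddSubgroup.zmultiples (2 * Real.pi) : Set ℝ) := by
      ext z; simp [AddSubgroup.mem_zmultiples_iff]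
    rw [this]
    exact inferInstanceAs (DiscreteTopology (AddSubgroup.zmultiples (2 * Real.pi)))
  exact hS.constant_of_mapsTo (isDiscrete_iff_discreteTopology.2 this) hD hmaps hx hy

theorem lineMap_mem_segment {a c : ℝ × ℝ} {t : ℝ} (h0 : 0 ≤ t) (h1 : t ≤ 1) :
    AffineMap.lineMap a c t ∈ segment ℝ a c := by
  rw [segment_eq_image_lineMap]
  exact ⟨t, ⟨h0, h1⟩, rfl⟩

theorem planeToComplex_lineMap (a c : ℝ × ℝ) (t : ℝ) :
    ζ (AffineMap.lineMap a c t) = ζ a + t * (ζ c - ζ a) := by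
  rw [AffineMap.lineMap_apply, vsub_eq_sub, vadd_eq_add, map_add, map_smul, map_sub,
    Complex.real_smul, add_comm]

/-- Applied to the directions z and w of the first segments of two arcs, which cannot point the same
way. -/
theorem div_mem_slitPlane_of_not_pos {z w : ℂ} (hz : z ≠ 0) (hw : w ≠ 0)
    (h : ∀ t : ℝ, 0 < t → w ≠ t * z) : -w / z ∈ Complex.slitPlane := by
  rw [Complex.mem_slitPlane_iff_not_le_zero]
  intro hle
  obtain ⟨h1, h2⟩ := Complex.le_def.1 hle
  set r := -w / z with hr
  have hrr : r = ((r.re : ℝ) : ℂ) := by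
    apply Complex.ext <;> simp_all
  have hne : r ≠ 0 := div_ne_zero (neg_ne_zero.2 hw) hz
  have : r.re ≠ 0 := fun h0 => hne (by rw [hrr, h0]; simp)
  refine h (-r.re) (by simp at h1; rcases h1.lt_or_eq with h | h; linarith; exact absurd h this) ?_
  push_cast
  rw [← hrr, hr]
  field_simp

/-- The limit of a view angle when approaching the start `a` of a segment along another one. -/
theorem tendsto_viewAngle_lineMap {a c d : ℝ × ℝ} (hc : a ≠ c)
    (hs : -(ζ d - ζ a) / (ζ c - ζ a) ∈ Complex.slitPlane) :
    Tendsto (fun t : ℝ => viewAngle a d (AffineMap.lineMap a c t)) (𝓝[>] 0)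
      (𝓝 (Complex.arg (-(ζ d - ζ a) / (ζ c - ζ a)))) := by
  have hne : ζ c - ζ a ≠ 0 := sub_ne_zero.2 fun h => hc (planeToComplex.injective h).symm
  have key : Tendsto (fun t : ℝ => Complex.arg ((ζ d - ζ a - t * (ζ c - ζ a)) / (-(ζ c - ζ a))))
      (𝓝 0) (𝓝 (Complex.arg (-(ζ d - ζ a) / (ζ c - ζ a)))) := by
    have : ContinuousAt (fun t : ℝ => (ζ d - ζ a - t * (ζ c - ζ a)) / (-(ζ c - ζ a))) 0 := by
      apply Continuous.continuousAt
      fun_prop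
    have h2 := ContinuousAt.tendsto (Complex.continuousAt_arg hs)
    refine h2.comp ?_
    have h3 := this.tendsto
    convert h3 using 2
    rw [Complex.ofReal_zero, zero_mul, sub_zero, neg_div, div_neg]
  refine (key.mono_left nhdsWithin_le_nhds).congr' ?_
  filter_upwards [self_mem_nhdsWithin] with t ht
  have ht : (0 : ℝ) < t := ht
  unfold viewAngle
  rw [planeToComplex_lineMap]
  -- The quotient blows up as t tends to 0, but only by the positive real factor t⁻¹, which does not
  -- change the argument.
  have e : (ζ d - (ζ a + t * (ζ c - ζ a))) / (ζ a - (ζ a + t * (ζ c - ζ a))) =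
      ((t⁻¹ : ℝ) : ℂ) * ((ζ d - ζ a - t * (ζ c - ζ a)) / (-(ζ c - ζ a))) := by
    have : (t : ℂ) ≠ 0 := by exact_mod_cast ht.ne'
    push_cast
    rw [show ζ a - (ζ a + t * (ζ c - ζ a)) = t * (-(ζ c - ζ a)) by ring]
    field_simp
    ring
  rw [e, Complex.arg_real_mul _ (inv_pos.2 ht)]

/-- Of three arcs with common ends that are disjoint otherwise, not all can have an inner point in
the closure of a connected set that is disjoint from them. -/
theorem theta_arcs_false {a b : ℝ × ℝ} {A : Fin 3 → Set (ℝ × ℝ)} {F : Set (ℝ × ℝ)}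
    (hA : ∀ i, IsPolygonalArc a b (A i)) (hAA : ∀ i j, i ≠ j → A i ∩ A j ⊆ {a, b})
    (hF : IsPreconnected F) (hFn : F.Nonempty) (hFA : ∀ i, Disjoint F (A i))
    {x : Fin 3 → ℝ × ℝ} (hx : ∀ i, x i ∈ A i \ {a, b}) (hxF : ∀ i, x i ∈ closure F) : False := by
  choose c η hac hseg hη hθ using fun i => (hA i).exists_first_segment
  obtain ⟨z, hz⟩ := hFn
  have hab := (hA 0).ne
  have hS : ∀ i, IsPreconnected (F ∪ (A i \ {a, b})) := fun i => by
    have h1 : IsPreconnected (insert (x i) F) :=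
      hF.subset_closure (subset_insert _ _) (insert_subset (hxF i) subset_closure)
    have := h1.union (x i) (mem_insert _ _) (hx i) (hA i).isPreconnected_diff
    rwa [insert_union, insert_eq_of_mem (show x i ∈ F ∪ (A i \ {a, b}) from Or.inr (hx i))] at this
  have hdisj : ∀ i j, i ≠ j → ∀ p ∈ F ∪ (A i \ {a, b}), p ∉ A j := fun i j hij p hp hpj => by
    rcases hp with hp | hp
    · exact Set.disjoint_left.1 (hFA j) hp hpj
    · exact hp.2 (hAA i j hij ⟨hp.1, hpj⟩)
  -- near `a`, the first segment of an arc consists of inner points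
  have hin : ∀ i, ∀ᶠ t : ℝ in 𝓝[>] 0, AffineMap.lineMap a (c i) t ∈ A i \ {a, b} := fun i => by
    have hcont : Tendsto (fun t : ℝ => (AffineMap.lineMap a (c i) t : ℝ × ℝ)) (𝓝[>] 0) (𝓝 a) := by
      have : Continuous (fun t : ℝ => (AffineMap.lineMap a (c i) t : ℝ × ℝ)) := by fun_prop
      have := this.tendsto 0
      simp only [AffineMap.lineMap_apply_zero] at this
      exact this.mono_left nhdsWithin_le_nhds
    filter_upwards [self_mem_nhdsWithin, hcont.eventually_ne hab,
      nhdsWithin_le_nhds (Iic_mem_nhds (zero_lt_one' ℝ))] with t ht htb ht1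
    have ht : (0 : ℝ) < t := ht
    refine ⟨hseg i (lineMap_mem_segment ht.le ht1), ?_⟩
    rintro (h | h)
    · simp [hac i, ht.ne'] at h
    · exact htb h
  have hv : ∀ i, ζ (c i) - ζ a ≠ 0 := fun i =>
    sub_ne_zero.2 fun h => hac i (planeToComplex.injective h).symm
  -- First segments with the same direction would overlap near a, in inner points of both arcs.
  have hslit : ∀ i j, i ≠ j →
      -(ζ (c j) - ζ a) / (ζ (c i) - ζ a) ∈ Complex.slitPlane := fun i j hij => by
    apply div_mem_slitPlane_of_not_pos (hv i) (hv j)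
    intro s hs heq
    have hscale : Tendsto (fun t : ℝ => s * t) (𝓝[>] 0) (𝓝[>] 0) := by
      apply tendsto_nhdsWithin_of_tendsto_nhds_of_eventually_within
      · have : Continuous fun t : ℝ => s * t := by fun_prop
        have := this.tendsto 0
        rw [mul_zero] at this
        exact this.mono_left nhdsWithin_le_nhds
      · filter_upwards [self_mem_nhdsWithin] with t ht
        exact mul_pos hs ht
    obtain ⟨t, h1, h2⟩ := ((hin j).and (hscale.eventually (hin i))).exists
    have : (AffineMap.lineMap a (c j) t : ℝ × ℝ) = AffineMap.lineMap a (c i) (s * t) := by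
      apply planeToComplex.injective
      rw [planeToComplex_lineMap, planeToComplex_lineMap, heq]
      push_cast; ring
    rw [this] at h1
    exact h1.2 (hAA j i hij.symm ⟨h1.1, h2.1⟩)
  set R : Fin 3 → Fin 3 → ℝ := fun i j => Complex.arg (-(ζ (c j) - ζ a) / (ζ (c i) - ζ a)) with hR
  set Θ : Fin 3 → ℝ × ℝ → ℝ := fun i p => viewAngle a (c i) p + η i p with hΘ
  have hlim : ∀ i j, i ≠ j → Tendsto (fun t : ℝ => Θ j (AffineMap.lineMap a (c i) t)) (𝓝[>] 0)
      (𝓝 (R i j + η j a)) := fun i j hij => by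
    refine (tendsto_viewAngle_lineMap (hac i) (hslit i j hij)).add ((hη j).tendsto.comp ?_)
    have : Continuous (fun t : ℝ => (AffineMap.lineMap a (c i) t : ℝ × ℝ)) := by fun_prop
    have := this.tendsto 0
    simp only [AffineMap.lineMap_apply_zero] at this
    exact this.mono_left nhdsWithin_le_nhds
  -- The difference is constant on F together with the inner points of arc i, so its value at z is
  -- its limit at a along that arc.
  have hval : ∀ i j k, i ≠ j → i ≠ k →
      Θ j z - Θ k z = (R i j + η j a) - (R i k + η k a) := fun i j k hij hik => by
    have hconst : ∀ p ∈ F ∪ (A i \ {a, b}), Θ j p - Θ k p = Θ j z - Θ k z := fun p hp => by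
      refine eq_of_isPreconnected_of_coe_eq_zero (D := fun q => Θ j q - Θ k q) (hS i) ?_ ?_ hp
        (Or.inl hz)
      · intro q hq
        exact (((hθ j).continuousAt q (hdisj i j hij q hq)).sub
          ((hθ k).continuousAt q (hdisj i k hik q hq))).continuousWithinAt
      · intro q hq
        rw [Real.Angle.coe_sub, (hθ j).coe_eq q (hdisj i j hij q hq),
          (hθ k).coe_eq q (hdisj i k hik q hq), sub_self]
    refine tendsto_nhds_unique (tendsto_const_nhds.congr' ?_)
      ((hlim i j hij).sub (hlim i k hik))
    filter_upwards [hin i] with t ht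
    exact (hconst _ (Or.inr ht)).symm
  have hneg : ∀ i j, i ≠ j → R i j = - R j i := fun i j hij => by
    simp only [hR]
    have h := Complex.mem_slitPlane_iff_arg.1 (hslit j i hij.symm)
    have : -(ζ (c j) - ζ a) / (ζ (c i) - ζ a) = (-(ζ (c i) - ζ a) / (ζ (c j) - ζ a))⁻¹ := by
      rw [inv_div, div_neg, neg_div]
    rw [this, Complex.arg_inv, if_neg h.1]
  have e0 := hval 0 1 2 (by decide) (by decide)
  have e1 := hval 1 2 0 (by decide) (by decide)
  have e2 := hval 2 0 1 (by decide) (by decide)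
  have n0 := hneg 0 2 (by decide)
  have n1 := hneg 1 0 (by decide)
  have n2 := hneg 2 1 (by decide)
  -- In the cyclic sum all terms Θ and η cancel, and the antisymmetry of R leaves twice this sum.
  have hX : R 0 1 + R 1 2 + R 2 0 = 0 := by linarith
  -- The three quotients multiply to (-1)³ = -1.
  have hX' : ((R 0 1 + R 1 2 + R 2 0 : ℝ) : Real.Angle) = (Real.pi : ℝ) := by
    have hq : ∀ i j, -(ζ (c j) - ζ a) / (ζ (c i) - ζ a) ≠ 0 := fun i j =>
      div_ne_zero (neg_ne_zero.2 (hv j)) (hv i)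
    rw [Real.Angle.coe_add, Real.Angle.coe_add, hR,
      ← Complex.arg_mul_coe_angle (hq _ _) (hq _ _),
      ← Complex.arg_mul_coe_angle (mul_ne_zero (hq _ _) (hq _ _)) (hq _ _), ← Complex.arg_neg_one]
    congr 2
    have := hv 0; have := hv 1; have := hv 2
    field_simp
  rw [hX, Real.Angle.coe_zero] at hX'
  exact Real.Angle.pi_ne_zero hX'.symm

end SimpleGraph

/-! ### Theta-free graphs: Hamiltonian cycles and crossing chords -/

namespace SimpleGraph

variable {V : Type*} {G : SimpleGraph V}

/-- No two vertices of `G` are the ends of three paths that are disjoint otherwise and have at least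
one inner vertex each. -/
def IsThetaFree (G : SimpleGraph V) : Prop :=
  ∀ (a b : V) (A B C : List V), A ≠ [] → B ≠ [] → C ≠ [] → (a :: b :: (A ++ B ++ C)).Nodup →
    (a :: A ++ [b]).IsChain G.Adj → (a :: B ++ [b]).IsChain G.Adj →
    (a :: C ++ [b]).IsChain G.Adj → False

namespace PlaneEmbedding

theorem isPolygonalArc_arc (P : G.PlaneEmbedding) {u v : V} (h : G.Adj u v) :
    IsPolygonalArc (P.point u) (P.point v) (P.arc ⟨s(u, v), h⟩) := P.isPolygonalArc u v h

/-- The last clause serves to show that internally disjoint paths with inner vertices share no edge,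
so that their arcs meet only in the common ends. -/
theorem exists_arc_of_isChain (P : G.PlaneEmbedding) (A : List V) (a b : V)
    (hn : (a :: A ++ [b]).Nodup) (hc : (a :: A ++ [b]).IsChain G.Adj) :
    ∃ S, IsPolygonalArc (P.point a) (P.point b) S ∧ (∀ x ∈ A, P.point x ∈ S) ∧
      ∀ y ∈ S, ∃ e, y ∈ P.arc e ∧ (∀ w ∈ e.1, w ∈ a :: A ++ [b]) ∧ (A ≠ [] → ∃ w ∈ A, w ∈ e.1) := by
  induction A generalizing a with
  | nil =>
    have h : G.Adj a b := by simpa using hc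
    refine ⟨_, P.isPolygonalArc_arc h, by simp, fun y hy => ⟨_, hy, ?_, by simp⟩⟩
    intro w hw
    simpa using hw
  | cons x A ih =>
    obtain ⟨hax, hc'⟩ : G.Adj a x ∧ (x :: A ++ [b]).IsChain G.Adj := by simpa using hc
    have hn' : a ∉ x :: A ++ [b] ∧ (x :: A ++ [b]).Nodup := by
      rw [List.cons_append] at hn
      exact List.nodup_cons.1 hn
    obtain ⟨S, hS, hAS, hSe⟩ := ih x hn'.2 hc'
    refine ⟨_, (P.isPolygonalArc_arc hax).trans hS ?_, ?_, ?_⟩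
    · apply Subset.antisymm
      · rintro y ⟨hy, hyS⟩
        obtain ⟨e, hye, hew, -⟩ := hSe y hyS
        have hne : (⟨s(a, x), hax⟩ : G.edgeSet) ≠ e := by
          rintro rfl
          exact hn'.1 (hew a (Sym2.mem_mk_left _ _))
        obtain ⟨w, hw1, hw2, rfl⟩ := P.arc_inter _ _ hne y ⟨hy, hye⟩
        rcases Sym2.mem_iff.1 hw1 with rfl | rfl
        · exact absurd (hew _ hw2) hn'.1
        · rfl
      · rintro _ rfl
        exact ⟨(P.isPolygonalArc_arc hax).right_mem, hS.left_mem⟩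
    · intro z hz
      rcases List.mem_cons.1 hz with rfl | hz
      · exact Or.inr hS.left_mem
      · exact Or.inr (hAS z hz)
    · rintro y (hy | hy)
      · refine ⟨_, hy, ?_, fun _ => ⟨x, by simp, by simp⟩⟩
        intro w hw
        rcases Sym2.mem_iff.1 hw with rfl | rfl <;> simp
      · obtain ⟨⟨e, he⟩, hye, hew, -⟩ := hSe y hy
        refine ⟨_, hye, fun w hw => List.mem_cons_of_mem _ (hew w hw), fun _ => ?_⟩
        induction e with
        | h u v =>
          have hu := hew u (by simp)
          have hv := hew v (by simp)
          have huv : u ≠ v := G.ne_of_adj he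
          rw [List.mem_append, List.mem_singleton] at hu hv
          by_cases hub : u = b
          · exact ⟨v, hv.resolve_right fun h => huv (hub.trans h.symm), by simp⟩
          · exact ⟨u, hu.resolve_right hub, by simp⟩

end PlaneEmbedding

/-- A face with all vertices on its boundary accumulates at an inner vertex of each of the three
paths, contrary to `theta_arcs_false`. -/
theorem IsOuterplanar.isThetaFree (h : G.IsOuterplanar) : G.IsThetaFree := by
  obtain ⟨P, F, ⟨z, hz, rfl⟩, -, hv⟩ := h
  intro a b A B C hA hB hC hn cA cB cC
  set T : Fin 3 → List V := ![A, B, C] with hT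
  have hTne : ∀ i, T i ≠ [] := by
    intro i; fin_cases i <;> simpa [hT]
  have hTc : ∀ i, (a :: T i ++ [b]).IsChain G.Adj := by
    intro i; fin_cases i <;> simpa [hT]
  have hTn : ∀ i, (a :: T i ++ [b]).Nodup := by
    intro i; fin_cases i <;> simp [hT] <;> grind
  have hTd : ∀ i j, i ≠ j → List.Disjoint (T i) (T j) := by
    intro i j hij x hx hy
    fin_cases i <;> fin_cases j <;> simp [hT] at hx hy hij <;> grind
  choose S hS hTS hSe using fun i => P.exists_arc_of_isChain (T i) a b (hTn i) (hTc i)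
  have hab : a ≠ b := by grind
  have hpt : ∀ i, ∀ x ∈ T i, P.point x ∈ S i \ {P.point a, P.point b} := fun i x hx => by
    refine ⟨hTS i x hx, ?_⟩
    have := hTn i
    rintro (h | h) <;> have := P.point_injective h <;> grind
  refine theta_arcs_false (A := S) (F := connectedComponentIn P.carrierᶜ z)
    (x := fun i => P.point ((T i).head (hTne i))) hS ?_ isPreconnected_connectedComponentIn
    ⟨z, mem_connectedComponentIn hz⟩ ?_ (fun i => hpt i _ (List.head_mem _))
    (fun i => frontier_subset_closure (hv _))
  · rintro i j hij y ⟨hyi, hyj⟩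
    obtain ⟨e, hye, hew, hex⟩ := hSe i y hyi
    obtain ⟨f, hyf, hfw, -⟩ := hSe j y hyj
    have hmem : ∀ w, w ∈ a :: T i ++ [b] → w ∈ a :: T j ++ [b] → w = a ∨ w = b := by
      intro w h1 h2
      have := hTd i j hij (a := w)
      grind
    by_cases hef : e = f
    · subst hef
      obtain ⟨w, hwT, hwe⟩ := hex (hTne i)
      have := hmem w (hew w hwe) (hfw w hwe)
      have := hTn i
      grind
    · obtain ⟨w, hw1, hw2, rfl⟩ := P.arc_inter _ _ hef y ⟨hye, hyf⟩
      rcases hmem w (hew w hw1) (hfw w hw2) with rfl | rfl <;> simp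
  · intro i
    rw [Set.disjoint_left]
    intro y hy hyS
    obtain ⟨e, hye, -⟩ := hSe i y hyS
    exact connectedComponentIn_subset _ _ hy (Or.inr (mem_iUnion.2 ⟨e, hye⟩))

theorem isChain_adj_reverse {u v : V} {D : List V} (hD : (u :: D ++ [v]).IsChain G.Adj) :
    (v :: D.reverse ++ [u]).IsChain G.Adj := by
  have h : (u :: D ++ [v]).IsChain (fun a b => G.Adj b a) := hD.imp fun _ _ h => h.symm
  simpa using List.isChain_reverse.2 h

/-- Reduces distinctness in a rearranged part of a list to linear arithmetic on multiplicities. -/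
theorem nodup_of_count_le {K L : List V} [DecidableEq V] (hL : L.Nodup)
    (h : ∀ z, K.count z ≤ L.count z) : K.Nodup :=
  List.nodup_iff_count_le_one.2 fun z => (h z).trans (List.nodup_iff_count_le_one.1 hL z)

/-- The list `a :: A` runs once around a closed walk without repeated vertices: a cycle, or an edge
traversed back and forth. -/
structure IsClosedChain (G : SimpleGraph V) (a : V) (A : List V) : Prop where
  nodup : (a :: A).Nodup
  isChain : (a :: A ++ [a]).IsChain G.Adj

theorem IsClosedChain.rotate_append {x a : V} {S T : List V}
    (h : G.IsClosedChain x (S ++ a :: T)) : G.IsClosedChain a (T ++ x :: S) := by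
  classical
  refine ⟨nodup_of_count_le h.nodup fun z => by
    simp only [List.count_cons, List.count_append]; omega, ?_⟩
  have h1 : (x :: S ++ a :: (T ++ [x])).IsChain G.Adj := by simpa using h.isChain
  rw [List.isChain_split] at h1
  have h2 : (a :: T ++ x :: (S ++ [a])).IsChain G.Adj :=
    List.isChain_split.2 ⟨by simpa using h1.2, by simpa using h1.1⟩
  simpa using h2

theorem IsClosedChain.rotate {x a : V} {A : List V} (h : G.IsClosedChain x A) (ha : a ∈ x :: A) :
    ∃ B, G.IsClosedChain a B ∧ (a :: B).Perm (x :: A) := by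
  rcases List.mem_cons.1 ha with rfl | ha
  · exact ⟨A, h, List.Perm.refl _⟩
  · obtain ⟨S, T, rfl⟩ := List.append_of_mem ha
    refine ⟨_, h.rotate_append, ?_⟩
    rw [← List.cons_append, ← List.cons_append]
    exact List.perm_append_comm

/-- Following a walk until it reaches `s` for the first time, after removing repetitions. -/
theorem exists_isChain_of_walk {s : Set V} {u v : V} (p : G.Walk u v) (hu : u ∉ s) (hv : v ∈ s) :
    ∃ (B : List V) (b : V), b ∈ s ∧ b ∈ p.support ∧ (∀ z ∈ u :: B, z ∉ s ∧ z ∈ p.support) ∧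
      (u :: B).Nodup ∧ (u :: B ++ [b]).IsChain G.Adj := by
  induction p with
  | nil => exact absurd hv hu
  | @cons u w v h p ih =>
    by_cases hw : w ∈ s
    · exact ⟨[], w, hw, by simp, by simpa using hu, by simp, by simpa using h⟩
    · obtain ⟨B, b, hb, hbp, hB, hn, hc⟩ := ih hw hv
      by_cases huB : u ∈ w :: B
      -- The path found from w returns to u; the loop is dropped and only the part T after u is
      -- kept.
      · obtain ⟨S, T, hST⟩ := List.append_of_mem huB
        refine ⟨T, b, hb, by simp [hbp], ?_, ?_, ?_⟩
        · intro z hz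
          have := hB z (by rw [hST]; simp_all)
          exact ⟨this.1, by simp [this.2]⟩
        · rw [hST] at hn
          exact hn.of_append_right
        · rw [hST, List.append_assoc] at hc
          exact hc.right_of_append
      · refine ⟨w :: B, b, hb, by simp [hbp], ?_, by grind, ?_⟩
        · intro z hz
          rcases List.mem_cons.1 hz with rfl | hz
          · exact ⟨hu, by simp⟩
          · exact ⟨(hB z hz).1, by simp [(hB z hz).2]⟩
        · simpa using ⟨h, hc⟩

/-- In a 2-connected graph a set with at least two vertices that misses a vertex has an ear. -/
theorem IsTwoConnected.exists_ear (h : G.IsTwoConnected) {s : Set V} (hs : s.Nontrivial)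
    {z : V} (hz : z ∉ s) : ∃ (a b : V) (B : List V), a ∈ s ∧ b ∈ s ∧ a ≠ b ∧ B ≠ [] ∧
      (∀ w ∈ B, w ∉ s) ∧ B.Nodup ∧ (a :: B ++ [b]).IsChain G.Adj := by
  obtain ⟨x, hx⟩ := hs.nonempty
  obtain ⟨p⟩ := h.2.1.preconnected x z
  obtain ⟨⟨⟨a, w⟩, haw⟩, -, ha, hw⟩ := p.exists_boundary_dart s hx hz
  simp only at ha hw haw
  obtain ⟨y, hy, hya⟩ := hs.exists_ne a
  -- After leaving s along the edge from a to w, the ear returns to s inside G - a, so its other end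
  -- differs from a.
  obtain ⟨q⟩ := (h.2.2 a).preconnected ⟨w, haw.ne.symm⟩ ⟨y, hya⟩
  obtain ⟨B, b, hb, hbp, hB, hn, hc⟩ := exists_isChain_of_walk
    (q.map (Embedding.induce ({a}ᶜ : Set V)).toHom) (s := s) hw hy
  refine ⟨a, b, w :: B, ha, hb, ?_, by simp, fun z hz => (hB z hz).1, hn, ?_⟩
  · rintro rfl
    rw [Walk.support_map] at hbp
    obtain ⟨c, -, hc⟩ := List.mem_map.1 hbp
    exact c.2 hc
  · exact List.isChain_cons_cons.2 ⟨haw, hc⟩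

/-- A 2-connected graph without theta subgraphs has a Hamiltonian cycle. -/
theorem IsTwoConnected.exists_isClosedChain [Finite V] (h : G.IsTwoConnected)
    (ht : G.IsThetaFree) : ∃ (a : V) (A : List V), G.IsClosedChain a A ∧ ∀ v, v ∈ a :: A := by
  classical
  have := Fintype.ofFinite V
  set N : Set ℕ := {n | ∃ (a : V) (A : List V), G.IsClosedChain a A ∧ (a :: A).length = n} with hN
  have hbdd : BddAbove N := by
    refine ⟨Fintype.card V, ?_⟩
    rintro _ ⟨a, A, hA, rfl⟩
    exact hA.nodup.length_le_card
  have hne : N.Nonempty := by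
    obtain ⟨a⟩ := h.2.1.nonempty
    have : Nontrivial V := by
      rw [← Finite.one_lt_card_iff_nontrivial, ← Nat.cast_lt (α := ℕ∞), ← ENat.card_eq_coe_natCard]
      exact lt_trans (by norm_num) h.1
    obtain ⟨b, hab⟩ := h.2.1.preconnected.exists_adj_of_nontrivial a
    refine ⟨2, a, [b], ⟨by simpa using hab.ne, ?_⟩, rfl⟩
    simpa using ⟨hab, hab.symm⟩
  obtain ⟨x, L, hL, hlen⟩ := Nat.sSup_mem hne hbdd
  have hmax : ∀ a A, G.IsClosedChain a A → (a :: A).length ≤ (x :: L).length := fun a A hA => by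
    rw [hlen]
    exact le_csSup hbdd ⟨a, A, hA, rfl⟩
  refine ⟨x, L, hL, ?_⟩
  by_contra! hz
  obtain ⟨z, hz⟩ := hz
  have hs : {v | v ∈ x :: L}.Nontrivial := by
    rcases L with _ | ⟨y, L⟩
    · simpa using hL.isChain
    · exact ⟨x, by simp, y, by simp, by have := hL.nodup; grind⟩
  obtain ⟨a, b, B, ha, hb, hab, hB, hBs, hBn, hBc⟩ := h.exists_ear hs hz
  obtain ⟨C, hC, hperm⟩ := hL.rotate ha
  have hbC : b ∈ C := by
    have := hperm.symm.subset hb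
    exact (List.mem_cons.1 this).resolve_left hab.symm
  obtain ⟨A₁, A₂, rfl⟩ := List.append_of_mem hbC
  have hBC : ∀ w ∈ B, w ∉ a :: (A₁ ++ b :: A₂) := fun w hw hw' => hBs w hw (hperm.subset hw')
  have hlenC := hperm.length_eq
  have hBl : 0 < B.length := List.length_pos_iff.2 hB
  have hnod : (B ++ a :: (A₁ ++ b :: A₂)).Nodup := hBn.append hC.nodup fun w => hBC w
  have hch : (a :: A₁ ++ b :: (A₂ ++ [a])).IsChain G.Adj := by simpa using hC.isChain
  rw [List.isChain_split] at hch
  obtain ⟨h1, h2⟩ := hch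
  -- If a and b are neighbors on the cycle, the ear replaces the edge between them and gives a
  -- longer cycle; otherwise both sides of the cycle and the ear form a theta.
  by_cases hA₁ : A₁ = []
  · subst hA₁
    have : G.IsClosedChain a (B ++ b :: A₂) := by
      refine ⟨nodup_of_count_le hnod fun z => by
        simp only [List.count_cons, List.count_append, List.count_nil]; omega, ?_⟩
      have : (a :: B ++ b :: (A₂ ++ [a])).IsChain G.Adj := List.isChain_split.2 ⟨hBc, h2⟩
      simpa using this
    have := hmax _ _ this
    simp at this hlenC
    omega
  by_cases hA₂ : A₂ = []
  · subst hA₂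
    have : G.IsClosedChain a (A₁ ++ b :: B.reverse) := by
      refine ⟨nodup_of_count_le hnod fun z => by
        simp only [List.count_cons, List.count_append, List.count_reverse, List.count_nil]; omega, ?_⟩
      have : (a :: A₁ ++ b :: (B.reverse ++ [a])).IsChain G.Adj :=
        List.isChain_split.2 ⟨h1, isChain_adj_reverse hBc⟩
      simpa using this
    have := hmax _ _ this
    simp at this hlenC
    omega
  exact ht a b A₁ A₂.reverse B hA₁ (by simpa using hA₂) hB (nodup_of_count_le hnod fun z => by
    simp only [List.count_cons, List.count_append, List.count_reverse]; omega) h1 (isChain_adj_reverse h2) hBc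

/-- Without theta subgraphs, crossing chords of a Hamiltonian cycle leave no vertex between their
ends. -/
theorem IsThetaFree.eq_nil_of_crossing (ht : G.IsThetaFree) {a b c d : V} {A B C D : List V}
    (h : G.IsClosedChain a (A ++ b :: (B ++ c :: (C ++ d :: D)))) (hac : G.Adj a c)
    (hbd : G.Adj b d) : A = [] := by
  classical
  by_contra hA
  have hn := h.nodup
  have hc : (a :: A ++ b :: (B ++ c :: (C ++ d :: (D ++ [a])))).IsChain G.Adj := by
    simpa using h.isChain
  rw [List.isChain_split] at hc
  have h2 : (b :: B ++ c :: (C ++ d :: (D ++ [a]))).IsChain G.Adj := by simpa using hc.2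
  rw [List.isChain_split] at h2
  have h3 : (c :: C ++ d :: (D ++ [a])).IsChain G.Adj := by simpa using h2.2
  rw [List.isChain_split] at h3
  -- The theta has ends a and b: one path follows A, one takes the chord to c and returns through B,
  -- one goes back through D to d and takes the chord to b.
  refine ht a b A (c :: B.reverse) (D.reverse ++ [d]) hA (by simp) (by simp) (nodup_of_count_le hn fun z => by
    simp only [List.count_cons, List.count_append, List.count_reverse, List.count_nil]; omega) hc.1 ?_ ?_
  · exact List.isChain_cons_cons.2 ⟨hac, isChain_adj_reverse h2.1⟩
  · have : (a :: D.reverse ++ d :: [b]).IsChain G.Adj :=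
      List.isChain_split.2 ⟨isChain_adj_reverse (by simpa using h3.2), by simpa using hbd.symm⟩
    simpa using this

/-- The crossing pattern is invariant under rotation of the cycle, so all four gaps are empty. -/
theorem IsThetaFree.length_eq_of_crossing (ht : G.IsThetaFree) {a b c d : V} {A B C D : List V}
    (h : G.IsClosedChain a (A ++ b :: (B ++ c :: (C ++ d :: D)))) (hac : G.Adj a c)
    (hbd : G.Adj b d) : (a :: (A ++ b :: (B ++ c :: (C ++ d :: D)))).length = 4 := by
  have hA := ht.eq_nil_of_crossing h hac hbd
  have h1 : G.IsClosedChain b (B ++ c :: (C ++ d :: (D ++ a :: A))) := by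
    simpa using h.rotate_append
  have hB := ht.eq_nil_of_crossing h1 hbd hac.symm
  have h2 : G.IsClosedChain c (C ++ d :: (D ++ a :: (A ++ b :: B))) := by
    simpa using h1.rotate_append
  have hC := ht.eq_nil_of_crossing h2 hac.symm hbd.symm
  have h3 : G.IsClosedChain d (D ++ a :: (A ++ b :: (B ++ c :: C))) := by
    simpa using h2.rotate_append
  have hD := ht.eq_nil_of_crossing h3 hbd.symm hac
  simp [hA, hB, hC, hD]

end SimpleGraph

namespace SimpleGraph

/-! ### Colorings of a path with non-crossing chords

The vertices are the natural numbers in `[i, j)`, and `f` sends a vertex to the other end of its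
chord, or to itself if it has none. Vertex `k` lies between the path edges `k` and `k + 1`. The
colors are the elements of `Fin 4`. -/

/-- Two colors that form an interval. -/
def IsRun₂ (x y : Fin 4) : Prop := x.val + 1 = y.val ∨ y.val + 1 = x.val

/-- Three colors that form an interval. -/
def IsRun₃ (x c y : Fin 4) : Prop := (x ≠ c ∧ c ≠ y ∧ x ≠ y) ∧
  ((x ≠ 0 ∧ c ≠ 0 ∧ y ≠ 0) ∨ (x ≠ 3 ∧ c ≠ 3 ∧ y ≠ 3))

instance (x y : Fin 4) : Decidable (IsRun₂ x y) := inferInstanceAs (Decidable (_ ∨ _))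

instance (x c y : Fin 4) : Decidable (IsRun₃ x c y) := inferInstanceAs (Decidable (_ ∧ _))

/-- The binary relation on colors with a given table of truth values, written as a binary number. -/
def maskRel (m : ℕ) (x y : Fin 4) : Bool := m.testBit (4 * x.val + y.val)

/-- The tables of the empty path and of one, two and three vertices without chords. -/
def chordlessMasks : List ℕ := [33825, 19026, 42405, 23130]

/-- The tables of paths whose ends are joined by a chord; the first one admits
no pair of equal colors. -/
def chordMasks : List ℕ := [27606, 64959, 28662, 65535]

/-- The tables that suffice for all paths with non-crossing chords. -/
def pathMasks : List ℕ := chordlessMasks ++ chordMasks ++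
  [63471, 49149, 65151, 32766, 57339, 61431]

/-- Tables are only lower bounds for the realizable pairs, so a finite family closed under the
constructions suffices, and closure is a finite check. The side conditions let the induction
recognize from the table an empty path, a path whose ends are joined by a chord, and a chordless
path. -/
theorem exists_mask_cons : ∀ s ∈ pathMasks, ∃ r ∈ pathMasks,
    (∀ x z, maskRel r x z → ∃ y, IsRun₂ x y ∧ maskRel s y z) ∧ r ≠ 33825 ∧ r ≠ 27606 ∧
      (r ∈ chordlessMasks → s ∈ chordlessMasks) := by
  decide +kernel

/-- Here c is the color of the chord, and x', y' are those of the path edges just inside its ends.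
The table 33825 of the empty path is left out since a chord encloses a vertex. -/
theorem exists_mask_chord : ∀ r ∈ pathMasks, r ≠ 33825 → ∃ p ∈ chordMasks,
    (∀ x y, maskRel p x y → ∃ c x' y', IsRun₃ x c x' ∧ IsRun₃ y' c y ∧ maskRel r x' y') := by
  decide +kernel

/-- The color y belongs to the path edge shared by the block under a chord and the rest. The table
27606 survives only if nothing follows the block. -/
theorem exists_mask_append : ∀ p ∈ chordMasks, ∀ s ∈ pathMasks, ∃ r ∈ pathMasks,
    (∀ x z, maskRel r x z → ∃ y, maskRel p x y ∧ maskRel s y z) ∧ r ∉ chordlessMasks ∧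
      (r = 27606 → s = 33825) := by
  decide +kernel

/-- A pair of equal colors is what closes the path to a cycle. Without chords the parity of the
color changes at every vertex, so an odd number of vertices admits no such pair. -/
theorem exists_maskRel_self : ∀ r ∈ pathMasks, r ∉ chordlessMasks → r ≠ 27606 →
    ∃ x, maskRel r x x := by
  decide +kernel

/-- 33825 = 2^0 + 2^5 + 2^10 + 2^15 has exactly the diagonal bits. -/
theorem eq_of_maskRel_id : ∀ x y : Fin 4, maskRel 33825 x y → x = y := by
  decide +kernel

/-- `f` describes non-crossing chords with ends in `[i, j)`, each enclosing at least one vertex. -/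
def IsChordMap (f : ℕ → ℕ) (i j : ℕ) : Prop :=
  ∀ k, i ≤ k → k < j → (i ≤ f k ∧ f k < j) ∧ f (f k) = k ∧ f k ≠ k + 1 ∧
    ∀ l, k < l → l < f k → k < f l ∧ f l < f k

/-- The colors `e` of the path edges and `c` of the chords form an interval at vertex `k`. -/
def IsColoredAt (f : ℕ → ℕ) (e c : ℕ → Fin 4) (k : ℕ) : Prop :=
  c (f k) = c k ∧ (f k = k → IsRun₂ (e k) (e (k + 1))) ∧
    (f k ≠ k → IsRun₃ (e k) (c k) (e (k + 1)))

/-- The vertices in `[i, j)` can be colored with every pair of colors of the outermost edges that is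
admitted by the table `m`. -/
def RealizesMask (f : ℕ → ℕ) (i j m : ℕ) : Prop :=
  ∀ x y, maskRel m x y → ∃ e c : ℕ → Fin 4, e i = x ∧ e j = y ∧
    ∀ k, i ≤ k → k < j → IsColoredAt f e c k

theorem RealizesMask.cons {f : ℕ → ℕ} {i j r s : ℕ} (hij : i < j) (hi : f i = i)
    (h : RealizesMask f (i + 1) j s)
    (hr : ∀ x z, maskRel r x z → ∃ y, IsRun₂ x y ∧ maskRel s y z) : RealizesMask f i j r := by
  intro x z hxz
  obtain ⟨y, hxy, hyz⟩ := hr x z hxz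
  obtain ⟨e, c, hei, hej, hec⟩ := h y z hyz
  refine ⟨fun k => if k = i then x else e k, c, by simp, by simp [hej, hij.ne'], ?_⟩
  intro k hik hkj
  rcases hik.eq_or_lt with rfl | hik
  · refine ⟨by rw [hi], fun _ => ?_, fun h => absurd hi h⟩
    simpa [hei] using hxy
  · have := hec k hik hkj
    simpa [IsColoredAt, hik.ne', (hik.trans (Nat.lt_succ_self k)).ne'] using this

theorem RealizesMask.append {f : ℕ → ℕ} {i m j p s r : ℕ} (him : i < m) (hmj : m < j)
    (hi : f i = m) (hm : f m = i) (h₁ : ∀ k, i < k → k < m → i < f k ∧ f k < m)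
    (h₂ : ∀ k, m < k → k < j → m < f k) {q : ℕ} (hq : RealizesMask f (i + 1) m q)
    (hs : RealizesMask f (m + 1) j s)
    (hp : ∀ x y, maskRel p x y → ∃ c x' y', IsRun₃ x c x' ∧ IsRun₃ y' c y ∧ maskRel q x' y')
    (hr : ∀ x z, maskRel r x z → ∃ y, maskRel p x y ∧ maskRel s y z) : RealizesMask f i j r := by
  intro x z hxz
  obtain ⟨y, hxy, hyz⟩ := hr x z hxz
  obtain ⟨a, x', y', hx, hy, hxy'⟩ := hp x y hxy
  obtain ⟨e₁, c₁, h1i, h1m, hc₁⟩ := hq x' y' hxy'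
  obtain ⟨e₂, c₂, h2m, h2j, hc₂⟩ := hs y z hyz
  -- Path edge k precedes vertex k: edge m is still under the chord, edge m + 1 belongs to the rest.
  -- The chord from i to m gets color a.
  refine ⟨fun k => if k = i then x else if k ≤ m then e₁ k else e₂ k,
    fun k => if k = i ∨ k = m then a else if k < m then c₁ k else c₂ k, by simp, ?_, ?_⟩
  · simp [(him.trans hmj).ne', hmj.not_ge, h2j]
  intro k hik hkj
  rcases hik.eq_or_lt with rfl | hik
  · refine ⟨by simp [hi], fun h => by omega, fun _ => ?_⟩
    have : i + 1 ≤ m := him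
    simpa [this, h1i] using hx
  rcases lt_trichotomy k m with hkm | rfl | hkm
  · obtain ⟨g1, g2, g3⟩ := hc₁ k hik hkm
    obtain ⟨u1, u2⟩ := h₁ k hik hkm
    have e1 : k ≠ i := by omega
    have e2 : k + 1 ≠ i := by omega
    have e3 : k + 1 ≤ m := by omega
    refine ⟨?_, fun h => ?_, fun h => ?_⟩
    · simp [e1, u1.ne', u2.ne, hkm.ne, hkm, u2, g1]
    · simpa [e1, e2, e3, hkm.le] using g2 h
    · simpa [e1, e2, e3, hkm.le, hkm.ne, hkm] using g3 h
  · refine ⟨by simp [hm], fun h => by omega, fun _ => ?_⟩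
    have e2 : k + 1 ≠ i := by omega
    simpa [him.ne', e2, h1m, h2m] using hy
  · obtain ⟨g1, g2, g3⟩ := hc₂ k hkm hkj
    have u := h₂ k hkm hkj
    have e1 : k ≠ i := by omega
    have e2 : k + 1 ≠ i := by omega
    have e3 : ¬ k + 1 ≤ m := by omega
    have e4 : f k ≠ i := by omega
    refine ⟨?_, fun h => ?_, fun h => ?_⟩
    · simp [e1, e4, u.ne', u.not_gt, hkm.ne', hkm.not_gt, g1]
    · simpa [e1, e2, e3, hkm.not_ge] using g2 h
    · simpa [e1, e2, e3, hkm.not_ge, hkm.not_gt, hkm.ne'] using g3 h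

/-- Strong induction on the length, according to the first vertex i: if it has no chord it is split
off; if its chord ends at m, the path splits into the part enclosed by the chord and the part after
m. -/
theorem IsChordMap.exists_mask {f : ℕ → ℕ} {i j : ℕ} (h : IsChordMap f i j) (hij : i ≤ j) :
    ∃ r ∈ pathMasks, RealizesMask f i j r ∧ (r = 33825 → i = j) ∧
      (r = 27606 → f i + 1 = j) ∧ (r ∈ chordlessMasks → ∀ k, i ≤ k → k < j → f k = k) := by
  induction hd : j - i using Nat.strong_induction_on generalizing i j with
  | _ d ih =>
  rcases hij.eq_or_lt with rfl | hij
  · refine ⟨33825, by decide, ?_, by simp, by simp, fun _ k _ _ => by omega⟩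
    intro x y hxy
    have := eq_of_maskRel_id x y hxy
    exact ⟨fun _ => x, fun _ => x, rfl, this, fun k _ _ => by omega⟩
  have hi := h i le_rfl hij
  by_cases hfi : f i = i
  · have hf : ∀ k, i < k → k < j → i < f k := fun k hk hkj => by
      have := h k hk.le hkj
      rcases this.1.1.eq_or_lt with h0 | h0
      · rw [← h0] at this; omega
      · exact h0
    have h' : IsChordMap f (i + 1) j := fun k hk hkj => by
      have := h k (by omega) hkj
      exact ⟨⟨hf k hk hkj, this.1.2⟩, this.2⟩
    obtain ⟨s, hs, hsr, -, -, s4⟩ := ih _ (by omega) h' hij rfl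
    obtain ⟨r, hr, hrel, r1, r2, r4⟩ := exists_mask_cons s hs
    refine ⟨r, hr, RealizesMask.cons hij hfi hsr hrel, fun h => absurd h r1,
      fun h => absurd h r2, ?_⟩
    intro h k hk hkj
    rcases hk.eq_or_lt with rfl | hk
    · exact hfi
    · exact s4 (r4 h) k hk hkj
  · set m := f i with hm
    have him : i < m := lt_of_le_of_ne hi.1.1 (Ne.symm hfi)
    have hmj := hi.1.2
    have hfm : f m = i := hi.2.1
    have h₁ : ∀ k, i < k → k < m → i < f k ∧ f k < m := hi.2.2.2
    have h₂ : ∀ k, m < k → k < j → m < f k := fun k hk hkj => by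
      have hk' := h k (by omega) hkj
      by_contra! hle
      rcases hle.eq_or_lt with h0 | h0
      · rw [h0, hfm] at hk'; omega
      rcases hk'.1.1.eq_or_lt with h0' | h0'
      · rw [← h0', ← hm] at hk'; omega
      · have := h₁ (f k) h0' h0
        rw [hk'.2.1] at this
        omega
    have hq' : IsChordMap f (i + 1) m := fun k hk hkm =>
      ⟨h₁ k hk hkm, (h k (by omega) (by omega)).2⟩
    have hs' : IsChordMap f (m + 1) j := fun k hk hkj =>
      ⟨⟨h₂ k hk hkj, (h k (by omega) hkj).1.2⟩, (h k (by omega) hkj).2⟩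
    obtain ⟨q, hq, hqr, q1, -, -⟩ := ih _ (by omega) hq' (by omega) rfl
    obtain ⟨s, hs, hsr, s1, -, -⟩ := ih _ (by omega) hs' (by omega) rfl
    obtain ⟨p, hp, hprel⟩ := exists_mask_chord q hq fun h0 => hi.2.2.1 (q1 h0).symm
    obtain ⟨r, hr, hrel, r1, r2⟩ := exists_mask_append p hp s hs
    refine ⟨r, hr, RealizesMask.append him hmj rfl hfm h₁ h₂ hqr hsr hprel hrel,
      fun h0 => absurd (h0 ▸ by decide) r1, fun h0 => s1 (r2 h0), fun h0 => absurd h0 r1⟩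

/-- A cycle with non-crossing chords, at least one of them, can be colored with four colors such that the colors at each vertex form an interval. -/
theorem IsChordMap.exists_isColoredAt {f : ℕ → ℕ} {n : ℕ} (h : IsChordMap f 0 n) (hn : f 0 + 1 ≠ n)
    {k : ℕ} (hk : k < n) (hfk : f k ≠ k) :
    ∃ e c : ℕ → Fin 4, e 0 = e n ∧ ∀ k < n, IsColoredAt f e c k := by
  obtain ⟨r, hr, hrr, -, h3, h0⟩ := h.exists_mask (Nat.zero_le n)
  -- The first and the last path edge are the two copies of the cut edge of the cycle and must agree
  -- in color.
  obtain ⟨x, hx⟩ := exists_maskRel_self r hr (fun h => hfk (h0 h k (Nat.zero_le k) hk))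
    (fun h => hn (h3 h))
  obtain ⟨e, c, h1, h2, h3⟩ := hrr x x hx
  exact ⟨e, c, h1.trans h2.symm, fun k hk => h3 k (Nat.zero_le k) hk⟩

end SimpleGraph

/-! ### From local conditions on a labeled cycle with chords to interval colorings -/

namespace SimpleGraph

variable {V : Type*} {G : SimpleGraph V}

/-- In a connected graph the colors form an interval if they do so at each vertex. -/
theorem Connected.mem_range_of_interval (hG : G.Connected) {α : G.EdgeLabeling ℕ}
    (hα : ∀ v : V, ∃ a b : ℕ, {c : ℕ | ∃ e : G.edgeSet, v ∈ e.1 ∧ α e = c} = Icc a b)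
    {e f : G.edgeSet} {c : ℕ} (he : α e ≤ c) (hf : c ≤ α f) : ∃ g, α g = c := by
  by_contra! hc
  have he := he.lt_of_ne (hc e)
  have hf := hf.lt_of_ne (hc f).symm
  -- If color c is missing, the interval at a vertex cannot jump over it, so being below c
  -- propagates along walks.
  have key : ∀ v : V, ∀ e f : G.edgeSet, v ∈ e.1 → v ∈ f.1 → α e < c → α f < c := by
    intro v e f hve hvf hec
    obtain ⟨a, b, hab⟩ := hα v
    by_contra! hcf
    have h1 : α e ∈ Icc a b := by rw [← hab]; exact ⟨e, hve, rfl⟩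
    have h2 : α f ∈ Icc a b := by rw [← hab]; exact ⟨f, hvf, rfl⟩
    have h3 : c ∈ Icc a b := ⟨h1.1.trans hec.le, hcf.trans h2.2⟩
    rw [← hab] at h3
    obtain ⟨g, -, hg⟩ := h3
    exact hc g hg
  have hwalk : ∀ u v : V, G.Walk u v → (∃ e : G.edgeSet, u ∈ e.1 ∧ α e < c) →
      ∃ e : G.edgeSet, v ∈ e.1 ∧ α e < c := by
    intro u v p
    induction p with
    | nil => exact id
    | @cons u w v h p ih =>
      rintro ⟨e, hue, hec⟩
      exact ih ⟨⟨s(u, w), h⟩, Sym2.mem_mk_right _ _,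
        key u e _ hue (Sym2.mem_mk_left _ _) hec⟩
  obtain ⟨u, hu⟩ : ∃ u, u ∈ e.1 := ⟨_, Sym2.out_fst_mem e.1⟩
  obtain ⟨v, hv⟩ : ∃ v, v ∈ f.1 := ⟨_, Sym2.out_fst_mem f.1⟩
  obtain ⟨p⟩ := hG.preconnected u v
  obtain ⟨g, hg, hgc⟩ := hwalk u v p ⟨e, hu, he⟩
  have := key v g f hg hv hgc
  omega

/-- A proper edge-coloring of a connected graph with intervals at the vertices can be shifted such
that the colors used are `1, …, t`. -/
theorem Connected.exists_isIntervalColoring (hG : G.Connected) {α : G.EdgeLabeling ℕ} {n : ℕ}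
    (hn : ∀ e, α e < n) (e₀ : G.edgeSet)
    (hp : ∀ (e f : G.edgeSet) (v : V), e ≠ f → v ∈ e.1 → v ∈ f.1 → α e ≠ α f)
    (hα : ∀ v : V, ∃ a b : ℕ, {c : ℕ | ∃ e : G.edgeSet, v ∈ e.1 ∧ α e = c} = Icc a b) :
    ∃ t, 0 < t ∧ t ≤ n ∧ ∃ β : G.EdgeLabeling ℕ, G.IsIntervalColoring t β := by
  have hfin : (range fun e => α e).Finite := (finite_Iio n).subset (by rintro _ ⟨e, rfl⟩; exact hn e)
  have hne : (range fun e => α e).Nonempty := ⟨_, e₀, rfl⟩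
  obtain ⟨_, ⟨e₁, rfl⟩, h₁⟩ := hfin.exists_minimal hne
  obtain ⟨_, ⟨e₂, rfl⟩, h₂⟩ := hfin.exists_maximal hne
  have hmin : ∀ e, α e₁ ≤ α e := fun e => by
    by_contra! h
    exact absurd (h₁ ⟨e, rfl⟩ h.le) h.not_ge
  have hmax : ∀ e, α e ≤ α e₂ := fun e => by
    by_contra! h
    exact absurd (h₂ ⟨e, rfl⟩ h.le) h.not_ge
  refine ⟨α e₂ - α e₁ + 1, by omega, by have := hn e₂; omega, fun e => α e - α e₁ + 1, ?_, ?_, ?_⟩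
  · intro e f v hef he hf h
    have h0 := hp e f v hef he hf
    have := hmin e
    have := hmin f
    have h : α e - α e₁ + 1 = α f - α e₁ + 1 := h
    omega
  · ext c
    constructor
    · rintro ⟨e, rfl⟩
      have := hmax e
      have := hmin e
      exact ⟨by simp, by simp only; omega⟩
    · rintro ⟨h1, h2⟩
      have := hmin e₂
      obtain ⟨g, hg⟩ := hG.mem_range_of_interval hα (e := e₁) (f := e₂)
        (c := c + α e₁ - 1) (by omega) (by omega)
      refine ⟨g, ?_⟩
      change α g - α e₁ + 1 = c
      omega
  · intro v
    obtain ⟨a, b, hab⟩ := hα v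
    by_cases hle : a ≤ b
    · have ha : a ∈ Icc a b := ⟨le_rfl, hle⟩
      rw [← hab] at ha
      obtain ⟨g, -, hg⟩ := ha
      have hma := hmin g
      refine ⟨a - α e₁ + 1, b - α e₁ + 1, ?_⟩
      ext c
      constructor
      · rintro ⟨e, he, rfl⟩
        have h : α e ∈ Icc a b := by rw [← hab]; exact ⟨e, he, rfl⟩
        have := h.1
        have := h.2
        change _ ≤ α e - α e₁ + 1 ∧ α e - α e₁ + 1 ≤ _
        omega
      · rintro ⟨h1, h2⟩
        have h : c + α e₁ - 1 ∈ Icc a b := ⟨by omega, by omega⟩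
        rw [← hab] at h
        obtain ⟨e, he, hec⟩ := h
        refine ⟨e, he, ?_⟩
        omega
    -- The spectrum is empty; shifting the old bounds could give a nonempty interval because of
    -- truncated subtraction.
    · refine ⟨1, 0, ?_⟩
      ext c
      simp only [mem_ofPred_eq, mem_Icc]
      constructor
      · rintro ⟨e, he, -⟩
        have h : α e ∈ Icc a b := by rw [← hab]; exact ⟨e, he, rfl⟩
        exact absurd (h.1.trans h.2) hle
      · omega

theorem IsRun₂.exists_eq_Icc {x y : Fin 4} (h : IsRun₂ x y) :
    ∃ a b : ℕ, ({x.val, y.val} : Set ℕ) = Icc a b := by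
  refine ⟨min x.val y.val, max x.val y.val, ?_⟩
  unfold IsRun₂ at h
  ext c
  simp only [mem_insert_iff, mem_singleton_iff, mem_Icc]
  omega

theorem IsRun₃.exists_eq_Icc {x c y : Fin 4} (h : IsRun₃ x c y) :
    ∃ a b : ℕ, ({x.val, y.val, c.val} : Set ℕ) = Icc a b := by
  obtain ⟨h1, h2⟩ := h
  simp only [ne_eq, Fin.ext_iff, Fin.val_zero, show (3 : Fin 4).val = 3 from rfl] at h1 h2
  rcases h2 with h2 | h2
  · refine ⟨1, 3, ?_⟩
    ext d
    simp only [mem_insert_iff, mem_singleton_iff, mem_Icc]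
    omega
  · refine ⟨0, 2, ?_⟩
    ext d
    simp only [mem_insert_iff, mem_singleton_iff, mem_Icc]
    omega

/-- The predecessor of `i` in the cycle `0, …, n - 1`. -/
def cyclePred (n i : ℕ) : ℕ := if i = 0 then n - 1 else i - 1

/-- The successor of `i` in the cycle `0, …, n - 1`. -/
def cycleSucc (n i : ℕ) : ℕ := if i + 1 = n then 0 else i + 1

/-- The vertices `v 0, …, v (n - 1)` form a Hamiltonian cycle of `G`. -/
structure IsHamiltonianLabeling (G : SimpleGraph V) (n : ℕ) (v : ℕ → V) : Prop where
  three_le : 3 ≤ n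
  inj : ∀ i < n, ∀ j < n, v i = v j → i = j
  surj : ∀ x, ∃ i < n, v i = x
  adj : ∀ i < n, G.Adj (v i) (v (cycleSucc n i))

/-- Apart from the Hamiltonian cycle `v`, the edges of `G` are the chords from `v i` to `v (f i)`,
where `f i ≠ i`. -/
structure IsChordLabeling (G : SimpleGraph V) (n : ℕ) (v : ℕ → V) (f : ℕ → ℕ) : Prop extends
    G.IsHamiltonianLabeling n v where
  lt : ∀ i < n, f i < n
  invol : ∀ i < n, f (f i) = i
  ne_pred : ∀ i < n, f i ≠ cyclePred n i
  ne_succ : ∀ i < n, f i ≠ cycleSucc n i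
  adj_iff : ∀ i < n, ∀ j < n, G.Adj (v i) (v j) ↔
    j = cyclePred n i ∨ j = cycleSucc n i ∨ (j = f i ∧ f i ≠ i)

/-- The color of the edge between the vertices with labels `i` and `j`. -/
def cycleColor (n : ℕ) (e c : ℕ → Fin 4) (i j : ℕ) : Fin 4 :=
  if j = i + 1 then e j else if i = j + 1 then e i
    else if (i = 0 ∧ j + 1 = n) ∨ (j = 0 ∧ i + 1 = n) then e 0 else c (min i j)

theorem cycleColor_comm (n : ℕ) (e c : ℕ → Fin 4) (i j : ℕ) :
    cycleColor n e c i j = cycleColor n e c j i := by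
  unfold cycleColor
  rw [min_comm]
  by_cases h1 : j = i + 1
  · have h2 : ¬ i = j + 1 := by omega
    rw [if_pos h1, if_neg h2, if_pos h1]
  · rw [if_neg h1]
    split_ifs <;> first | rfl | omega

/-- The colors at `v i` are `e i`, `e (i + 1)` and, if there is a chord, `c i`, so `IsColoredAt`
yields both properness and the interval condition. -/
theorem IsChordLabeling.interval_colorable {n : ℕ} {v : ℕ → V} {f : ℕ → ℕ}
    (h : G.IsChordLabeling n v f) (hG : G.Connected) {e c : ℕ → Fin 4} (hen : e 0 = e n)
    (hec : ∀ k < n, IsColoredAt f e c k) :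
    G.IsIntervalColorable ∧ G.minIntervalColors ≤ 4 := by
  have h3 := h.three_le
  choose idx hlt hidx using h.surj
  have hidxv : ∀ i < n, idx (v i) = i := fun i hi => h.inj _ (hlt _) _ hi (hidx _)
  set α : G.EdgeLabeling ℕ := fun ed =>
    Sym2.lift ⟨fun x y => (cycleColor n e c (idx x) (idx y)).val,
      fun x y => congrArg Fin.val (cycleColor_comm n e c (idx x) (idx y))⟩ ed.1 with hα
  have hαe : ∀ x y (hxy : G.Adj x y), α ⟨s(x, y), hxy⟩ = (cycleColor n e c (idx x) (idx y)).val :=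
    fun x y hxy => rfl
  have cpred : ∀ i < n, cycleColor n e c i (cyclePred n i) = e i := fun i hi => by
    unfold cycleColor cyclePred
    by_cases h0 : i = 0
    · subst h0
      have e1 : ¬ n - 1 = 1 := by omega
      have e2 : n - 1 + 1 = n := by omega
      simp [e1, e2]
    · have e1 : ¬ i - 1 = i + 1 := by omega
      have e2 : i = i - 1 + 1 := by omega
      simp only [h0, if_false, e1, ← e2, if_true]
  have csucc : ∀ i < n, cycleColor n e c i (cycleSucc n i) = e (i + 1) := fun i hi => by
    unfold cycleColor cycleSucc
    by_cases h0 : i + 1 = n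
    · have e1 : ¬ i = 1 := by omega
      have e2 : ¬ n = 0 := by omega
      simp [h0, e1, hen, Ne.symm e2]
    · simp [h0]
  have cchord : ∀ i < n, f i ≠ i → cycleColor n e c i (f i) = c i := fun i hi hfi => by
    have g1 := h.ne_pred i hi
    have g2 := h.ne_succ i hi
    have g3 := h.lt i hi
    unfold cyclePred at g1
    unfold cycleSucc at g2
    unfold cycleColor
    have e1 : ¬ f i = i + 1 := by split_ifs at g2 <;> omega
    have e2 : ¬ i = f i + 1 := by split_ifs at g1 <;> omega
    have e3 : ¬ ((i = 0 ∧ f i + 1 = n) ∨ (f i = 0 ∧ i + 1 = n)) := by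
      split_ifs at g1 g2 <;> omega
    rw [if_neg e1, if_neg e2, if_neg e3]
    -- A chord takes its color from its smaller end; both ends carry the same value of `c`.
    rcases min_choice i (f i) with h0 | h0 <;> rw [h0]
    exact (hec i hi).1
  -- the edges at a vertex and their colors
  have hedge : ∀ (i : ℕ), i < n → ∀ ed : G.edgeSet, v i ∈ ed.1 → ∃ j < n, ed.1 = s(v i, v j) ∧
      ((j = cyclePred n i ∧ α ed = e i) ∨ (j = cycleSucc n i ∧ α ed = e (i + 1)) ∨
        (j = f i ∧ f i ≠ i ∧ α ed = c i)) := by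
    rintro i hi ⟨ed, hed⟩ hmem
    obtain ⟨y, rfl⟩ := hmem
    refine ⟨idx y, hlt y, by simp [hidx], ?_⟩
    rw [hαe _ _ hed, hidxv i hi]
    have had : G.Adj (v i) (v (idx y)) := by rw [hidx]; exact hed
    rcases (h.adj_iff i hi _ (hlt y)).1 had with h0 | h0 | ⟨h0, h1⟩ <;> rw [h0]
    · exact Or.inl ⟨rfl, by rw [cpred i hi]⟩
    · exact Or.inr (Or.inl ⟨rfl, by rw [csucc i hi]⟩)
    · exact Or.inr (Or.inr ⟨rfl, h1, by rw [cchord i hi h1]⟩)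
  have hpn : ∀ i < n, cyclePred n i < n := fun i hi => by unfold cyclePred; split_ifs <;> omega
  have hsn : ∀ i < n, cycleSucc n i < n := fun i hi => by unfold cycleSucc; split_ifs <;> omega
  have hepred : ∀ i < n, ∃ ed : G.edgeSet, v i ∈ ed.1 ∧ α ed = e i := fun i hi => by
    have had := (h.adj_iff i hi _ (hpn i hi)).2 (Or.inl rfl)
    exact ⟨⟨_, had⟩, Sym2.mem_mk_left _ _, by
      rw [hαe _ _ had, hidxv i hi, hidxv _ (hpn i hi), cpred i hi]⟩
  have hesucc : ∀ i < n, ∃ ed : G.edgeSet, v i ∈ ed.1 ∧ α ed = e (i + 1) := fun i hi => by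
    have had := (h.adj_iff i hi _ (hsn i hi)).2 (Or.inr (Or.inl rfl))
    exact ⟨⟨_, had⟩, Sym2.mem_mk_left _ _, by
      rw [hαe _ _ had, hidxv i hi, hidxv _ (hsn i hi), csucc i hi]⟩
  have hechord : ∀ i < n, f i ≠ i → ∃ ed : G.edgeSet, v i ∈ ed.1 ∧ α ed = c i :=
    fun i hi hfi => by
    have had := (h.adj_iff i hi _ (h.lt i hi)).2 (Or.inr (Or.inr ⟨rfl, hfi⟩))
    exact ⟨⟨_, had⟩, Sym2.mem_mk_left _ _, by
      rw [hαe _ _ had, hidxv i hi, hidxv _ (h.lt i hi), cchord i hi hfi]⟩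
  have hne : ∀ i < n, e i ≠ e (i + 1) ∧ (f i ≠ i → e i ≠ c i ∧ c i ≠ e (i + 1)) := fun i hi => by
    obtain ⟨-, g1, g2⟩ := hec i hi
    refine ⟨?_, fun hfi => ⟨(g2 hfi).1.1, (g2 hfi).1.2.1⟩⟩
    by_cases hfi : f i = i
    · have := g1 hfi
      unfold IsRun₂ at this
      rw [Ne, Fin.ext_iff]
      omega
    · exact (g2 hfi).1.2.2
  have hprop : ∀ (ed fd : G.edgeSet) (x : V), ed ≠ fd → x ∈ ed.1 → x ∈ fd.1 → α ed ≠ α fd := by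
    intro ed fd x hne' hx hx'
    obtain ⟨i, hi, rfl⟩ := h.surj x
    obtain ⟨j, hj, hej, h1⟩ := hedge i hi ed hx
    obtain ⟨j', hj', hej', h2⟩ := hedge i hi fd hx'
    have hjj : j ≠ j' := by
      rintro rfl
      exact hne' (Subtype.ext (hej.trans hej'.symm))
    obtain ⟨n1, n2⟩ := hne i hi
    simp only [ne_eq, Fin.ext_iff] at n1 n2
    rcases h1 with ⟨a1, a2⟩ | ⟨a1, a2⟩ | ⟨a1, a3, a2⟩ <;>
      rcases h2 with ⟨b1, b2⟩ | ⟨b1, b2⟩ | ⟨b1, b3, b2⟩ <;> rw [a2, b2] <;> grind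
  have hint : ∀ x : V, ∃ a b : ℕ, {d : ℕ | ∃ ed : G.edgeSet, x ∈ ed.1 ∧ α ed = d} = Icc a b := by
    intro x
    obtain ⟨i, hi, rfl⟩ := h.surj x
    obtain ⟨-, g1, g2⟩ := hec i hi
    by_cases hfi : f i = i
    · obtain ⟨a, b, hab⟩ := (g1 hfi).exists_eq_Icc
      refine ⟨a, b, ?_⟩
      rw [← hab]
      ext d
      simp only [mem_ofPred_eq, mem_insert_iff, mem_singleton_iff]
      constructor
      · rintro ⟨ed, hed, rfl⟩
        obtain ⟨j, -, -, h1⟩ := hedge i hi ed hed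
        tauto
      · rintro (rfl | rfl)
        · exact hepred i hi
        · exact hesucc i hi
    · obtain ⟨a, b, hab⟩ := (g2 hfi).exists_eq_Icc
      refine ⟨a, b, ?_⟩
      rw [← hab]
      ext d
      simp only [mem_ofPred_eq, mem_insert_iff, mem_singleton_iff]
      constructor
      · rintro ⟨ed, hed, rfl⟩
        obtain ⟨j, -, -, h1⟩ := hedge i hi ed hed
        tauto
      · rintro (rfl | rfl | rfl)
        · exact hepred i hi
        · exact hesucc i hi
        · exact hechord i hi hfi
  obtain ⟨e₀, -⟩ := hepred 0 (by omega)
  have hα4 : ∀ ed, α ed < 4 := by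
    rintro ⟨ed, hed⟩
    induction ed with
    | h x y => rw [hαe _ _ hed]; exact Fin.isLt _
  obtain ⟨t, ht0, ht4, β, hβ⟩ := hG.exists_isIntervalColoring hα4 e₀ hprop hint
  exact ⟨⟨t, ht0, β, hβ⟩, le_trans (Nat.sInf_le (by exact ⟨ht0, β, hβ⟩)) ht4⟩

end SimpleGraph

/-! ### Labeling the Hamiltonian cycle and its chords -/

namespace SimpleGraph

variable {V : Type*} {G : SimpleGraph V}

theorem IsClosedChain.rotate_split {a x : V} {A S T : List V} (h : G.IsClosedChain a A)
    (hl : a :: A = S ++ x :: T) : G.IsClosedChain x (T ++ S) := by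
  rcases S with _ | ⟨b, S⟩
  · obtain ⟨rfl, rfl⟩ : a = x ∧ A = T := by simpa using hl
    simpa using h
  · obtain ⟨rfl, rfl⟩ : a = b ∧ A = S ++ x :: T := by simpa using hl
    exact h.rotate_append

theorem exists_append_four {l : List V} {i j k m : ℕ} (hij : i < j) (hjk : j < k)
    (hkm : k < m) (hm : m < l.length) : ∃ S A B C D,
      l = S ++ l[i] :: (A ++ l[j] :: (B ++ l[k] :: (C ++ l[m] :: D))) := by
  have key : ∀ p q (hpq : p < q) (hq : q < l.length), ∃ A,
      l.drop (p + 1) = A ++ l[q] :: l.drop (q + 1) := fun p q hpq hq => by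
    refine ⟨(l.drop (p + 1)).take (q - (p + 1)), ?_⟩
    rw [List.cons_getElem_drop_succ]
    conv_lhs => rw [← List.take_append_drop (q - (p + 1)) (l.drop (p + 1))]
    rw [List.drop_drop]
    congr 2
    omega
  obtain ⟨A, hA⟩ := key i j hij (by omega)
  obtain ⟨B, hB⟩ := key j k hjk (by omega)
  obtain ⟨C, hC⟩ := key k m hkm hm
  refine ⟨l.take i, A, B, C, l.drop (m + 1), ?_⟩
  rw [← hC, ← hB, ← hA, List.cons_getElem_drop_succ, List.take_append_drop]

/-- A 2-connected graph without theta subgraphs has a Hamiltonian cycle, in which no two chords cross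
unless there are just four vertices. -/
theorem IsTwoConnected.exists_isHamiltonianLabeling [Finite V] (h : G.IsTwoConnected)
    (ht : G.IsThetaFree) : ∃ (n : ℕ) (v : ℕ → V), G.IsHamiltonianLabeling n v ∧
      ∀ i j k m, i < j → j < k → k < m → m < n → G.Adj (v i) (v k) → G.Adj (v j) (v m) → n = 4 := by
  classical
  have := Fintype.ofFinite V
  obtain ⟨a, A, hA, hall⟩ := h.exists_isClosedChain ht
  have hv : ∀ i (hi : i < (a :: A).length), (a :: A).getD i a = (a :: A)[i] :=
    fun i hi => List.getD_eq_getElem _ _ hi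
  have hcard : (a :: A).length = Fintype.card V := by
    rw [← List.toFinset_card_of_nodup hA.nodup, ← Finset.card_univ]
    congr 1
    ext x
    simpa using hall x
  refine ⟨(a :: A).length, fun i => (a :: A).getD i a, ⟨?_, ?_, ?_, ?_⟩, ?_⟩
  · rw [hcard]
    have := h.1
    rw [ENat.card_eq_coe_fintype_card] at this
    exact_mod_cast this
  · intro i hi j hj hij
    simp only [hv _ hi, hv _ hj] at hij
    exact (hA.nodup.getElem_inj_iff).1 hij
  · intro x
    obtain ⟨i, hi, rfl⟩ := List.getElem_of_mem (hall x)
    exact ⟨i, hi, hv i hi⟩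
  · intro i hi
    have hc := List.isChain_iff_getElem.1 hA.isChain i (by simpa using hi)
    unfold cycleSucc
    rw [hv i hi]
    rw [List.getElem_append_left hi] at hc
    split_ifs with h0
    · rw [List.getElem_append_right h0.ge, List.getElem_singleton] at hc
      exact hc
    · rw [hv (i + 1) (by omega)]
      rwa [List.getElem_append_left (by omega)] at hc
  · intro i j k m hij hjk hkm hm hik hjm
    simp only at hik hjm
    rw [hv i (by omega), hv k (by omega)] at hik
    rw [hv j (by omega), hv m (by omega)] at hjm
    obtain ⟨S, B, C, D, E, hl⟩ := exists_append_four hij hjk hkm hm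
    have hrot := hA.rotate_split hl
    simp only [List.append_assoc, List.cons_append] at hrot
    have := ht.length_eq_of_crossing hrot hik hjm
    rw [← this]
    conv_lhs => rw [hl]
    simp only [List.length_append, List.length_cons]
    omega

/-- A Hamiltonian cycle without chords is all of the graph. -/
theorem IsHamiltonianLabeling.nonempty_iso_cycleGraph {n : ℕ} {v : ℕ → V}
    (h : G.IsHamiltonianLabeling n v)
    (hadj : ∀ i < n, ∀ j < n, G.Adj (v i) (v j) → j = cyclePred n i ∨ j = cycleSucc n i) :
    Nonempty (G ≃g cycleGraph n) := by
  have h3 := h.three_le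
  have hbij : Function.Bijective (fun i : Fin n => v i) := by
    refine ⟨fun i j hij => Fin.ext (h.inj i i.2 j j.2 hij), fun x => ?_⟩
    obtain ⟨i, hi, rfl⟩ := h.surj x
    exact ⟨⟨i, hi⟩, rfl⟩
  refine ⟨(RelIso.symm ⟨Equiv.ofBijective _ hbij, ?_⟩ : G ≃g cycleGraph n)⟩
  rintro ⟨i, hi⟩ ⟨j, hj⟩
  rw [cycleGraph_adj']
  simp only [Equiv.ofBijective_apply, Fin.sub_def]
  have hmod : ∀ i j, i < n → j < n →
      ((n - j + i) % n = 1 ↔ i = cycleSucc n j) := fun i j hi hj => by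
    unfold cycleSucc
    rcases Nat.lt_or_ge (n - j + i) n with h0 | h0
    · rw [Nat.mod_eq_of_lt h0]
      split_ifs <;> omega
    · rw [Nat.mod_eq_sub_mod h0, Nat.mod_eq_of_lt (by omega)]
      split_ifs <;> omega
  rw [hmod i j hi hj, hmod j i hj hi]
  constructor
  · intro had
    rcases hadj i hi j hj had with h0 | h0
    · left
      unfold cyclePred at h0
      unfold cycleSucc
      split_ifs at h0 ⊢ <;> omega
    · exact Or.inr h0
  · rintro (rfl | rfl)
    · exact (h.adj j hj).symm
    · exact h.adj i hi

/-- If the maximum degree is at most three, the chords of a Hamiltonian cycle form a matching. -/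
theorem IsHamiltonianLabeling.exists_isChordLabeling [Fintype V] [DecidableRel G.Adj] {n : ℕ}
    {v : ℕ → V} (h : G.IsHamiltonianLabeling n v) (hdeg : G.maxDegree ≤ 3) :
    ∃ f, G.IsChordLabeling n v f := by
  classical
  have h3 := h.three_le
  have hpn : ∀ i < n, cyclePred n i < n := fun i hi => by unfold cyclePred; split_ifs <;> omega
  have hsn : ∀ i < n, cycleSucc n i < n := fun i hi => by unfold cycleSucc; split_ifs <;> omega
  have hps : ∀ i < n, ∀ j < n, j = cyclePred n i ↔ i = cycleSucc n j := fun i hi j hj => by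
    unfold cyclePred cycleSucc; split_ifs <;> omega
  have hpne : ∀ i < n, cyclePred n i ≠ cycleSucc n i := fun i hi => by
    unfold cyclePred cycleSucc; split_ifs <;> omega
  have hpi : ∀ i < n, i ≠ cyclePred n i ∧ i ≠ cycleSucc n i := fun i hi => by
    unfold cyclePred cycleSucc; split_ifs <;> omega
  have hpadj : ∀ i < n, G.Adj (v i) (v (cyclePred n i)) := fun i hi => by
    have := h.adj _ (hpn i hi)
    rw [← (hps i hi _ (hpn i hi)).1 rfl] at this
    exact this.symm
  set Q : ℕ → ℕ → Prop := fun i j => j < n ∧ j ≠ cyclePred n i ∧ j ≠ cycleSucc n i ∧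
    G.Adj (v i) (v j) with hQ
  have hsymm : ∀ i j, i < n → Q i j → Q j i := fun i j hi ⟨q1, q2, q3, q4⟩ =>
    ⟨hi, fun h0 => q3 ((hps j q1 i hi).1 h0), fun h0 => q2 ((hps i hi j q1).2 h0), q4.symm⟩
  have huniq : ∀ i j k, i < n → Q i j → Q i k → j = k := by
    rintro i j k hi ⟨j1, j2, j3, j4⟩ ⟨k1, k2, k3, k4⟩
    by_contra hjk
    -- Two chords at `v i` would give it four distinct neighbors.
    have hinj : InjOn v ({cyclePred n i, cycleSucc n i, j, k} : Finset ℕ) := by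
      have := hpn i hi
      have := hsn i hi
      intro x hx y hy hxy
      refine h.inj x ?_ y ?_ hxy
      · simp at hx; omega
      · simp at hy; omega
    have hsub : ({cyclePred n i, cycleSucc n i, j, k} : Finset ℕ).image v ⊆
        G.neighborFinset (v i) := by
      intro x hx
      obtain ⟨y, hy, rfl⟩ := Finset.mem_image.1 hx
      rw [mem_neighborFinset]
      simp only [Finset.mem_insert, Finset.mem_singleton] at hy
      rcases hy with rfl | rfl | rfl | rfl
      · exact hpadj i hi
      · exact h.adj i hi
      · exact j4
      · exact k4
    have hc := Finset.card_le_card hsub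
    rw [Finset.card_image_of_injOn hinj, card_neighborFinset_eq_degree] at hc
    have hd := (G.degree_le_maxDegree (v i)).trans hdeg
    have h4 : ({cyclePred n i, cycleSucc n i, j, k} : Finset ℕ).card = 4 := by
      rw [Finset.card_insert_of_notMem, Finset.card_insert_of_notMem,
        Finset.card_insert_of_notMem, Finset.card_singleton]
      · simpa using hjk
      · simp [j3.symm, k3.symm]
      · simp [hpne i hi, j2.symm, k2.symm]
    omega
  set f : ℕ → ℕ := fun i => if hi : ∃ j, Q i j then hi.choose else i with hf
  have hfpos : ∀ i j, i < n → Q i j → f i = j := fun i j hi hij => by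
    have hex : ∃ j, Q i j := ⟨j, hij⟩
    simp only [hf, dif_pos hex]
    exact huniq i _ _ hi hex.choose_spec hij
  have hfneg : ∀ i, (¬ ∃ j, Q i j) → f i = i := fun i hi => by
    simp only [hf, dif_neg hi]
  have hcases : ∀ i < n, Q i (f i) ∨ ((¬ ∃ j, Q i j) ∧ f i = i) := fun i hi => by
    by_cases hex : ∃ j, Q i j
    · obtain ⟨j, hj⟩ := hex
      rw [hfpos i j hi hj]
      exact Or.inl hj
    · exact Or.inr ⟨hex, hfneg i hex⟩
  refine ⟨f, h, ?_, ?_, ?_, ?_, ?_⟩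
  · intro i hi
    rcases hcases i hi with h0 | ⟨-, h0⟩
    · exact h0.1
    · rwa [h0]
  · intro i hi
    rcases hcases i hi with h0 | ⟨-, h0⟩
    · exact hfpos _ _ h0.1 (hsymm _ _ hi h0)
    · rw [h0, h0]
  · intro i hi
    rcases hcases i hi with h0 | ⟨-, h0⟩
    · exact h0.2.1
    · rw [h0]; exact (hpi i hi).1
  · intro i hi
    rcases hcases i hi with h0 | ⟨-, h0⟩
    · exact h0.2.2.1
    · rw [h0]; exact (hpi i hi).2
  · intro i hi j hj
    constructor
    · intro had
      by_cases h1 : j = cyclePred n i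
      · exact Or.inl h1
      by_cases h2 : j = cycleSucc n i
      · exact Or.inr (Or.inl h2)
      have := hfpos i j hi ⟨hj, h1, h2, had⟩
      refine Or.inr (Or.inr ⟨this.symm, ?_⟩)
      rw [this]
      rintro rfl
      exact had.ne rfl
    · rintro (rfl | rfl | ⟨rfl, h0⟩)
      · exact hpadj i hi
      · exact h.adj i hi
      · rcases hcases i hi with h1 | ⟨-, h1⟩
        · exact h1.2.2.2
        · exact absurd h1 h0

/-- A chord with one end l strictly between k and `f k` and the other end outside would cross the
chord at k, whichever side it ends on. -/
theorem IsChordLabeling.isChordMap {n : ℕ} {v : ℕ → V} {f : ℕ → ℕ} (h : G.IsChordLabeling n v f)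
    (hcross : ∀ i j k m, i < j → j < k → k < m → m < n → G.Adj (v i) (v k) →
      ¬ G.Adj (v j) (v m)) : IsChordMap f 0 n := by
  have hadj : ∀ i < n, f i ≠ i → G.Adj (v i) (v (f i)) := fun i hi hfi =>
    (h.adj_iff i hi _ (h.lt i hi)).2 (Or.inr (Or.inr ⟨rfl, hfi⟩))
  intro k _ hk
  have hfk := h.lt k hk
  refine ⟨⟨Nat.zero_le _, hfk⟩, h.invol k hk, fun h0 => ?_, fun l hkl hlf => ?_⟩
  · refine h.ne_succ k hk ?_
    unfold cycleSucc
    rw [h0, if_neg (by omega)]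
  · have hl : l < n := hlf.trans hfk
    have hfl := h.lt l hl
    have ak := hadj k hk (by omega)
    have ik := h.invol k hk
    have il := h.invol l hl
    by_cases hll : f l = l
    · omega
    have al := hadj l hl hll
    have h1 : f l ≠ k := fun h0 => by rw [h0] at il; omega
    have h2 : f l ≠ f k := fun h0 => by rw [h0, ik] at il; omega
    by_contra hcon
    rcases Nat.lt_or_ge (f l) k with h3 | h3
    · exact hcross (f l) k l (f k) h3 hkl hlf hfk al.symm ak
    · exact hcross k l (f k) (f l) hkl hlf (by omega) hfl ak al

/-- An even cycle with chords that form a matching is colored with `1` and `2` alternately on the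
cycle, and with `0` on the chords. -/
theorem isColoredAt_alternating (f : ℕ → ℕ) (k : ℕ) :
    IsColoredAt f (fun i => if Even i then 1 else 2) (fun _ => 0) k := by
  refine ⟨rfl, fun _ => ?_, fun _ => ?_⟩ <;> by_cases hk : Even k <;>
    simp only [hk, Nat.even_add_one, not_true, not_false_iff, if_true, if_false] <;> decide

end SimpleGraph

theorem theorem1 {V : Type*} [Fintype V] (G : SimpleGraph V) [DecidableRel G.Adj]
    (h2 : G.IsTwoConnected) (hout : G.IsOuterplanar) (hdeg : G.maxDegree ≤ 3)
    (hodd : ¬ G.IsOddCycle) :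
    G.IsIntervalColorable ∧ G.minIntervalColors ≤ 4 := by
  obtain ⟨n, v, hv, hcross⟩ := h2.exists_isHamiltonianLabeling hout.isThetaFree
  obtain ⟨f, hf⟩ := hv.exists_isChordLabeling hdeg
  rcases Nat.even_or_odd n with hn | hn
  -- Crossing chords do no harm here, which covers the exceptional case of four vertices.
  · exact hf.interval_colorable h2.2.1 (e := fun i => if Even i then 1 else 2) (c := fun _ => 0)
      (by simp [hn]) (fun k _ => SimpleGraph.isColoredAt_alternating f k)
  · obtain ⟨k, hk, hfk⟩ : ∃ k < n, f k ≠ k := by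
      by_contra! hno
      refine hodd ⟨n, hv.three_le, hn, hv.nonempty_iso_cycleGraph fun i hi j hj hij => ?_⟩
      rcases (hf.adj_iff i hi j hj).1 hij with h0 | h0 | ⟨-, h0⟩
      · exact Or.inl h0
      · exact Or.inr h0
      · exact absurd (hno i hi) h0
    -- A chord from 0 to n - 1 would be parallel to the cut edge of the cycle.
    have h0 : f 0 + 1 ≠ n := fun h0 => hf.ne_pred 0 (by omega) (by simp [SimpleGraph.cyclePred]; omega)
    have hmap : SimpleGraph.IsChordMap f 0 n := hf.isChordMap fun i j k m h1 h2 h3 h4 h5 h6 => by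
      rw [hcross i j k m h1 h2 h3 h4 h5 h6] at hn
      exact absurd hn (by decide)
    obtain ⟨e, c, hen, hec⟩ := hmap.exists_isColoredAt h0 hk hfk
    exact hf.interval_colorable h2.2.1 hen hec
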